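/- **Setting.** Let $\mathcal X$ be a topological space and $\mu$ a Borel measure (for instance a Radon measure) on $\mathcal X$ with support $\mathcal X$. Let $I\subset(0,\infty)$ be an open interval, $\tau\in C^\infty(I)$ with $\tau'>0$ on $I$, and $h\in C^\infty(\tau(I))$ with $h''>0$ on $\tau(I)$. Put $\ell=h'\circ\tau$, $\chi_{h,\tau}=1/\ell'$, $s^\star_{h,\tau}=-\tau\cdot(h'\circ\tau)+h\circ\tau$ and $$d_{h,\tau}(t,s)=h(\tau(t))-h(\tau(s))-(\tau(t)-\tau(s))\,h'(\tau(s))\qquad(t,s\in I).$$ Let $\exp_{h,\tau}$ be the inverse of $\ell:I\to\ell(I)$, extended to $\mathbb R$ by $0$ below $\ell(I)$ and by $\infty$ above $\ell(I)$. Let $\mathcal P(\mu)$ be the set of positive probability densities with respect to $\mu$ (identified when equal $\mu$-a.e.), let $\mathcal P_I(\mu)$ be the set of those with values in $I$ $\mu$-a.e., and write $e_x(p)=p(x)\in(0,\infty)$. For a function $\phi$ on $I$, $\mathbb I_\phi(p)=\int_{\mathcal X}\phi(p(x))\,d\mu(x)$; "$\mathbb I_\phi\in\mathbb R^{\mathcal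 M}$" means that $\phi\circ p\in L^1(\mu)$ for all $p\in\mathcal M$. The $(h,\tau)$-divergence is $D_{h,\tau}(p,p')=\int_{\mathcal X} d_{h,\tau}(p(x),p'(x))\,d\mu(x)\in[0,\infty]$. $\mathfrak X(\mathcal M)$ denotes the smooth vector fields on $\mathcal M$. Let $\mathcal M\subset\mathcal P_I(\mu)$ carry the structure of an $n$-dimensional smooth, Hausdorff, second countable, connected manifold without boundary. It is a *statistical model* if there is a $\mu$-null set $\mathcal N$ such that the topology of $\mathcal M$ is induced by $(e_x)_{x\notin\mathcal N}$; $e_x$ is smooth on $\mathcal M$ for $x\notin\mathcal N$; the derivatives of $e_x$ of any order at a point of $\mathcal M$ are Borel in $x\in\mathcal X\setminus\mathcal N$; for $V\in\mathfrak X(\mathcal M)$, $V_p(e_x)=0$ for all $x\notin\mathcal N$ if and only if $V_p=0$; and $V_p(e_x)$, $V_p(We_x)$ are $\mu$-integrable in $x$ with integral $0$ for all $V,W\in\mathfrak X(\mathcal M)$, $p\in\mathcal M$. An *$\exp_{h,\tau}$-coordinate representation* $(U,\theta,T,c,\psi)$ consists of a coordinate system $(U,\theta)$, continuous $T:\mathcal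 X\to\mathbb R^n$ and $c:\mathcal X\to\mathbb R$, and a smooth $\psi:U\to\mathbb R$ (the normalization) such that $p(x)=\exp_{h,\tau}(\langle\theta(p),T(x)\rangle-c(x)-\psi(p))$ for all $p\in U$, $x\in\mathcal X$; it is global if $U=\mathcal M$. $\mathcal M$ is an *$\exp_{h,\tau}$-family* if it is a statistical model in which each point has such a representation. For $V\in\mathfrak X(\mathcal M)$ put $\widetilde V=(V,0)$, $\widehat V=(0,V)$ on $\mathcal M\times\mathcal M$. $\mathcal M$ is *$(h,\tau)$-compatible* if for all $V,W,Z\in\mathfrak X(\mathcal M)$ the functions $x\mapsto\widetilde V_{(p,p)}(\widehat W(d_{h,\tau}\circ(e_x,e_x)))$ and $x\mapsto\widehat Z_{(p,p)}(\widehat V\widetilde W(d_{h,\tau}\circ(e_x,e_x)))$ are in $L^1(\mu)$ and $$g^{h,\tau}_p(V,W)=-\int\widetilde V_{(p,p)}(\widehat W(d_{h,\tau}\circ(e_x,e_x)))\,d\mu,\qquad g^{h,\tau}_p(\nabla^{h,\tau}_ZV,W)=-\int\widehat Z_{(p,p)}(\widehat V\widetilde W(d_{h,\tau}\circ(e_x,e_x)))\,d\mu$$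 are smooth in $p$. A coordinate system is *affine* for a connection $\nabla$ if its Christoffel symbols vanish. A pair $(g,\nabla)$ of a Riemannian metric and a connection is a *Hessian structure* if $\nabla$ is flat (zero torsion and curvature) and locally $g=\nabla d\Psi$ for a smooth $\Psi$, called a potential. For an affine coordinate system $\xi$ and a potential $\Psi$, both defined on all of $\mathcal M$, the *canonical divergence* is $\overline D(p,p')=\Psi(p')-\Psi(p)+\langle\xi(p)-\xi(p'),(\partial_i\Psi|_p)_{i=1}^n\rangle$. **Theorem.** Let $\mathcal M$ be an $(h,\tau)$-compatible $\exp_{h,\tau}$-family in $\mathcal P_I(\mu)$. Assume $\mathbb I_{\chi_{h,\tau}}\in\mathbb R^{\mathcal M}$, $\mathbb I_\tau\in C^\infty(\mathcal M)$ and $$V_p(\mathbb I_\tau)=\int_{\mathcal X}V_p(\tau\circ e_x)\,d\mu(x)\qquad\text{for }V\in\mathfrak X(\mathcal M),\ p\in\mathcal M$$ (the integral being convergent). Then the formulas above define a smooth Riemannian metric $g^{h,\tau}$ and a smooth connection $\nabla^{h,\tau}$ on $\mathcal M$, global $\exp_{h,\tau}$-coordinate representations exist, and: 1. For each global $\exp_{h,\tau}$-coordinate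 representation $(\mathcal M,\theta,T,c,\psi)$, if $\mathbb I_\tau$ is constant on $\mathcal M$, then $(\mathcal M,\theta)$ is affine with respect to $\nabla^{h,\tau}$. Conversely, if $\chi_{h,\tau}'>0$ on $I$ and $(\mathcal M,\theta)$ is affine with respect to $\nabla^{h,\tau}$, then $\mathbb I_\tau$ is constant on $\mathcal M$. 2. Assume that $\mathbb I_\tau$ is constant on $\mathcal M$ and that $\mathbb I_{s^\star_{h,\tau}}\in C^\infty(\mathcal M)$ satisfies, for all $V,W\in\mathfrak X(\mathcal M)$ and $p\in\mathcal M$ (with convergent integrals), $$V_p(\mathbb I_{s^\star_{h,\tau}})=\int_{\mathcal X}V_p(s^\star_{h,\tau}\circ e_x)\,d\mu(x),\qquad V_p(W(\mathbb I_{s^\star_{h,\tau}}))=\int_{\mathcal X}V_p(W(s^\star_{h,\tau}\circ e_x))\,d\mu(x).$$ Then $(g^{h,\tau},\nabla^{h,\tau})$ is a Hessian structure on $\mathcal M$; for every global $\exp_{h,\tau}$-normalization $\psi$, the function $-\mathbb I_{s^\star_{h,\tau}}+\psi\,\mathbb I_\tau$ is a global potential; and the canonical divergence of $(g^{h,\tau},\nabla^{h,\tau})$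 on $\mathcal M$, computed from any global affine coordinate system and any global potential, equals $D_{h,\tau}$ (in particular $D_{h,\tau}$ is finite on $\mathcal M\times\mathcal M$). -/

import Mathlib

open MeasureTheory Set Filter Topology
open scoped Manifold ContDiff

noncomputable section

namespace InfoGeo

/-! ### The triples `(h, τ, I)` and the functions attached to them -/

/-- A triple `(h, τ, I)`: an open interval `I ⊆ (0, ∞)`, a smooth `τ` on `I` with `τ' > 0` on `I`,
and a smooth `h` on `τ(I)` with `h'' > 0` on `τ(I)`. The values of `τ` and `h` outside `I` and
`τ(I)` are irrelevant. -/
structure Gauge where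
  I : Set ℝ
  τ : ℝ → ℝ
  h : ℝ → ℝ
  isOpen_I : IsOpen I
  ordConnected_I : I.OrdConnected
  I_pos : I ⊆ Ioi 0
  smooth_τ : ContDiffOn ℝ ∞ τ I
  deriv_τ_pos : ∀ t ∈ I, 0 < deriv τ t
  smooth_h : ContDiffOn ℝ ∞ h (τ '' I)
  deriv2_h_pos : ∀ r ∈ τ '' I, 0 < iteratedDeriv 2 h r

namespace Gauge

variable (G : Gauge)

/-- `d(t, s) = h(τ(t)) - h(τ(s)) - (τ(t) - τ(s)) h'(τ(s))`. -/
def d (t s : ℝ) : ℝ := G.h (G.τ t) - G.h (G.τ s) - (G.τ t - G.τ s) * deriv G.h (G.τ s)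

/-- `ℓ = h' ∘ τ`. -/
def ell (t : ℝ) : ℝ := deriv G.h (G.τ t)

/-- `χ = 1 / ℓ'`. -/
def chi (t : ℝ) : ℝ := 1 / deriv G.ell t

/-- `s⋆ = - τ · (h' ∘ τ) + h ∘ τ`. -/
def sStar (t : ℝ) : ℝ := - G.τ t * deriv G.h (G.τ t) + G.h (G.τ t)

open Classical in
/-- The `(h, τ)`-exponential function: the inverse of `ℓ : I → ℓ(I)`, extended to `ℝ` by `0` below
`ℓ(I)` and by `∞` above `ℓ(I)`. -/
def expFn (u : ℝ) : EReal :=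
  if u ∈ G.ell '' G.I then ((Function.invFunOn G.ell G.I u : ℝ) : EReal)
  else if ∀ t ∈ G.I, u ≤ G.ell t then 0
  else ⊤

end Gauge

/-! ### Vector fields and their action on functions -/

/-- The model space of an `n`-dimensional manifold. -/
abbrev Model (n : ℕ) : Type := EuclideanSpace ℝ (Fin n)

/-- Smooth vector fields on the `n`-dimensional manifold `M`. -/
abbrev VField (n : ℕ) (M : Type*) [TopologicalSpace M] [ChartedSpace (Model n) M]
    [IsManifold 𝓘(ℝ, Model n) ∞ M] : Type _ :=
  ContMDiffSection 𝓘(ℝ, Model n) (Model n) ∞ (TangentSpace 𝓘(ℝ, Model n) : M → Type _)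

section Manifold

variable {n : ℕ} {M : Type*} [TopologicalSpace M] [ChartedSpace (Model n) M]

/-- `f` is a smooth real function on `M`. -/
def IsSmooth (n : ℕ) {M : Type*} [TopologicalSpace M] [ChartedSpace (Model n) M]
    (f : M → ℝ) : Prop :=
  ContMDiff 𝓘(ℝ, Model n) 𝓘(ℝ, ℝ) ∞ f

/-- `(V f)(p) = V_p(f)`, for a (not necessarily smooth) vector field `V`. -/
def lieD (V : ∀ p : M, TangentSpace 𝓘(ℝ, Model n) p) (f : M → ℝ) (p : M) : ℝ :=
  mvfderiv 𝓘(ℝ, Model n) f p (V p)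

/-- `Ṽ F`, where `Ṽ = (V, 0)` acts on a function `F` on `M × M`, written in curried form. -/
def lieFst (V : ∀ p : M, TangentSpace 𝓘(ℝ, Model n) p) (F : M → M → ℝ) : M → M → ℝ :=
  fun q r => lieD V (fun q' => F q' r) q

/-- `V̂ F`, where `V̂ = (0, V)` acts on a function `F` on `M × M`, written in curried form. -/
def lieSnd (V : ∀ p : M, TangentSpace 𝓘(ℝ, Model n) p) (F : M → M → ℝ) : M → M → ℝ :=
  fun q r => lieD V (fun r' => F q r') r

/-! ### Coordinate systems, connections, Hessian structures -/

/-- `(U, ξ)` with `U = ξ.source` is a (smooth) coordinate system on `M`. -/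
def IsCoordSystem (ξ : OpenPartialHomeomorph M (Model n)) : Prop :=
  ξ ∈ IsManifold.maximalAtlas 𝓘(ℝ, Model n) ∞ M

/-- The `i`-th coordinate vector field `∂_i` of `(U, ξ)`: on `U`, where `dξ` is
invertible, it is characterized by `dξ(∂_i) = e_i`. It is only used on `U`. -/
def coordField (ξ : OpenPartialHomeomorph M (Model n)) (i : Fin n) :
    ∀ p : M, TangentSpace 𝓘(ℝ, Model n) p :=
  fun p => (mvfderiv 𝓘(ℝ, Model n) ξ p).inverse (EuclideanSpace.single i (1 : ℝ))

/-- The canonical divergence in terms of a coordinate system `ξ` and a potential `Ψ`: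
`Ψ(p') - Ψ(p) + ⟨ξ(p) - ξ(p'), η(p)⟩` with `η = (∂_i Ψ)_i`. -/
def canonicalDiv (ξ : OpenPartialHomeomorph M (Model n)) (Ψ : M → ℝ) (p p' : M) : ℝ :=
  Ψ p' - Ψ p +
    inner ℝ (ξ p - ξ p') (WithLp.toLp 2 (fun i : Fin n => lieD (coordField ξ i) Ψ p) : Model n)

variable [IsManifold 𝓘(ℝ, Model n) ∞ M]

/-- Affine connections on `M`, as covariant derivatives on the tangent bundle. The value
`(∇_V W)(p)` is `nabla W p (V p)`. Smoothness is the separate condition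
`ContMDiffCovariantDerivative nabla ∞`. -/
abbrev Conn (n : ℕ) (M : Type*) [TopologicalSpace M] [ChartedSpace (Model n) M]
    [IsManifold 𝓘(ℝ, Model n) ∞ M] : Type _ :=
  CovariantDerivative 𝓘(ℝ, Model n) (Model n) (TangentSpace 𝓘(ℝ, Model n) : M → Type _)

/-- Smooth Riemannian metrics on `M`. -/
abbrev Metric (n : ℕ) (M : Type*) [TopologicalSpace M] [ChartedSpace (Model n) M]
    [IsManifold 𝓘(ℝ, Model n) ∞ M] : Type _ :=
  Bundle.ContMDiffRiemannianMetric 𝓘(ℝ, Model n) ∞ (Model n)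
    (TangentSpace 𝓘(ℝ, Model n) : M → Type _)

/-- The vector field `∇_V W`. -/
def Conn.along (nabla : Conn n M) (V W : ∀ p : M, TangentSpace 𝓘(ℝ, Model n) p) :
    ∀ p : M, TangentSpace 𝓘(ℝ, Model n) p :=
  fun p => nabla W p (V p)

/-- The Christoffel symbol `Γ_{ij}^k` of `∇` in the coordinate system `(U, ξ)` at `p ∈ U`: the
`k`-th component of `∇_{∂_i} ∂_j`. -/
def christoffel (nabla : Conn n M) (ξ : OpenPartialHomeomorph M (Model n)) (i j k : Fin n)
    (p : M) : ℝ :=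
  (mvfderiv 𝓘(ℝ, Model n) ξ p (nabla.along (coordField ξ i) (coordField ξ j) p)) k

/-- The coordinate system `(U, ξ)` is affine with respect to `∇`: all Christoffel symbols vanish
on `U`. -/
def IsAffineCoord (nabla : Conn n M) (ξ : OpenPartialHomeomorph M (Model n)) : Prop :=
  ∀ p ∈ ξ.source, ∀ i j k : Fin n, christoffel nabla ξ i j k p = 0

/-- `R(V, W) Z = ∇_V ∇_W Z - ∇_W ∇_V Z - ∇_{[V, W]} Z`. -/
def curvature (nabla : Conn n M) (V W Z : ∀ p : M, TangentSpace 𝓘(ℝ, Model n) p) :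
    ∀ p : M, TangentSpace 𝓘(ℝ, Model n) p :=
  fun p => nabla.along V (nabla.along W Z) p - nabla.along W (nabla.along V Z) p
    - nabla.along (VectorField.mlieBracket 𝓘(ℝ, Model n) V W) Z p

/-- The connection `∇` is flat: its torsion and its curvature vanish. -/
def IsFlat (nabla : Conn n M) : Prop :=
  (∀ p : M, CovariantDerivative.torsion nabla p = 0) ∧
  (∀ (V W Z : VField n M) (p : M), curvature nabla V W Z p = 0)

/-- `(∇ dΨ)(V, W) = V (W Ψ) - (∇_V W) Ψ`. -/
def hessian (nabla : Conn n M) (Ψ : M → ℝ) (V W : ∀ p : M, TangentSpace 𝓘(ℝ, Model n) p)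
    (p : M) : ℝ :=
  lieD V (lieD W Ψ) p - lieD (nabla.along V W) Ψ p

/-- `Ψ` is a local potential of `(g, ∇)` on the open set `U`: it is smooth on `U` and `g = ∇ dΨ`
on `U`. -/
def IsPotentialOn (g : Metric n M) (nabla : Conn n M) (U : Set M) (Ψ : M → ℝ) : Prop :=
  ContMDiffOn 𝓘(ℝ, Model n) 𝓘(ℝ, ℝ) ∞ Ψ U ∧
  ∀ (V W : VField n M), ∀ p ∈ U, g.inner p (V p) (W p) = hessian nabla Ψ V W p

/-- `(g, ∇)` is a Hessian structure: `∇` is flat and `(g, ∇)` has a potential locally around each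
point. -/
def IsHessianStructure (g : Metric n M) (nabla : Conn n M) : Prop :=
  IsFlat nabla ∧
  ∀ p : M, ∃ U : Set M, IsOpen U ∧ p ∈ U ∧ ∃ Ψ : M → ℝ, IsPotentialOn g nabla U Ψ

end Manifold

section Model

variable {X : Type*} [MeasurableSpace X] {n : ℕ} {M : Type*}

/-! ### Sets of probability densities, and integrals along them

A set `M` of probability densities on `X` is given by the evaluation map `e : M → X → ℝ`,
`e p x = e_x(p) = p(x)`. -/

/-- `M` is a subset of `𝒫(μ)`: each `p ∈ M` is a positive probability density, and different
elements of `M` are different as elements of `L¹(μ)`. -/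
structure IsDensitySet (μ : Measure X) (e : M → X → ℝ) : Prop where
  pos : ∀ p x, 0 < e p x
  integrable : ∀ p, Integrable (e p) μ
  integral_eq_one : ∀ p, ∫ x, e p x ∂μ = 1
  injective : ∀ p q, e p =ᵐ[μ] e q → p = q

/-- `𝕀_φ(p) = ∫ φ(p(x)) dμ(x)`. -/
def II (μ : Measure X) (e : M → X → ℝ) (φ : ℝ → ℝ) (p : M) : ℝ :=
  ∫ x, φ (e p x) ∂μ

/-- `𝕀_φ ∈ ℝ^M`: the integral `𝕀_φ(p)` exists for each `p ∈ M`. -/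
def IIExists (μ : Measure X) (e : M → X → ℝ) (φ : ℝ → ℝ) : Prop :=
  ∀ p, Integrable (fun x => φ (e p x)) μ

/-- The `(h, τ)`-divergence, with values in `[0, ∞]` (the integrand is nonnegative). -/
def divergence (G : Gauge) (μ : Measure X) (e : M → X → ℝ) (p p' : M) : ENNReal :=
  ∫⁻ x, ENNReal.ofReal (G.d (e p x) (e p' x)) ∂μ

variable [TopologicalSpace M] [ChartedSpace (Model n) M] [IsManifold 𝓘(ℝ, Model n) ∞ M]

/-- `𝕀_φ ∈ C^∞(M)`. -/
def IISmooth (n : ℕ) {M : Type*} [TopologicalSpace M] [ChartedSpace (Model n) M]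
    (μ : Measure X) (e : M → X → ℝ) (φ : ℝ → ℝ) : Prop :=
  IIExists μ e φ ∧ IsSmooth n (II μ e φ)

/-- First derivatives of `𝕀_φ` may be computed under the integral sign:
`V_p(𝕀_φ) = ∫ V_p(φ ∘ e_x) dμ(x)`, where the integral exists. -/
def Exchange₁ (n : ℕ) {M : Type*} [TopologicalSpace M] [ChartedSpace (Model n) M]
    [IsManifold 𝓘(ℝ, Model n) ∞ M] (μ : Measure X) (e : M → X → ℝ) (φ : ℝ → ℝ) : Prop :=
  ∀ (V : VField n M) (p : M),
    Integrable (fun x => lieD V (fun q => φ (e q x)) p) μ ∧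
    lieD V (II μ e φ) p = ∫ x, lieD V (fun q => φ (e q x)) p ∂μ

/-- Second derivatives of `𝕀_φ` may be computed under the integral sign:
`V_p(W 𝕀_φ) = ∫ V_p(W (φ ∘ e_x)) dμ(x)`, where the integral exists. -/
def Exchange₂ (n : ℕ) {M : Type*} [TopologicalSpace M] [ChartedSpace (Model n) M]
    [IsManifold 𝓘(ℝ, Model n) ∞ M] (μ : Measure X) (e : M → X → ℝ) (φ : ℝ → ℝ) : Prop :=
  ∀ (V W : VField n M) (p : M),
    Integrable (fun x => lieD V (lieD W (fun q => φ (e q x))) p) μ ∧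
    lieD V (lieD W (II μ e φ)) p = ∫ x, lieD V (lieD W (fun q => φ (e q x))) p ∂μ

/-! ### Statistical models -/

/-- The `n`-dimensional manifold `M` with evaluation map `e` is a statistical model in `𝒫(μ)`. -/
structure IsStatisticalModel (n : ℕ) {M : Type*} [TopologicalSpace M] [ChartedSpace (Model n) M]
    [IsManifold 𝓘(ℝ, Model n) ∞ M] (μ : Measure X) (e : M → X → ℝ) : Prop where
  isDensitySet : IsDensitySet μ e
  /-- Conditions involving one common null set `N`: the topology of `M` is induced by the functions
  `e_x`, `x ∉ N`; these functions are smooth; their derivatives of any order at a given point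
  (`V_1 ⋯ V_k e_x` at `p`, for a list of vector fields) are Borel in `x`; and `V_p(e_x) = 0` for
  all `x ∉ N` if and only if `V_p = 0`. -/
  exists_null : ∃ N : Set X, μ N = 0 ∧
    ((inferInstance : TopologicalSpace M) =
      ⨅ x : (Nᶜ : Set X), TopologicalSpace.induced (fun p => e p x) inferInstance) ∧
    (∀ x ∉ N, IsSmooth n (fun p => e p x)) ∧
    (∀ (Vs : List (VField n M)) (p : M), Measurable (fun x : (Nᶜ : Set X) =>
      Vs.foldr (fun (V : VField n M) (f : M → ℝ) => lieD V f) (fun q => e q x) p)) ∧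
    (∀ (V : VField n M) (p : M), (∀ x ∉ N, lieD V (fun q => e q x) p = 0) ↔ V p = 0)
  /-- Integrals of first and second derivatives of `e_x` exist and vanish. -/
  integral_lieD : ∀ (V : VField n M) (p : M),
    Integrable (fun x => lieD V (fun q => e q x) p) μ ∧ ∫ x, lieD V (fun q => e q x) p ∂μ = 0
  integral_lieD_lieD : ∀ (V W : VField n M) (p : M),
    Integrable (fun x => lieD V (lieD W (fun q => e q x)) p) μ ∧
    ∫ x, lieD V (lieD W (fun q => e q x)) p ∂μ = 0

/-! ### `(h, τ)`-exponential families -/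

/-- An `(h, τ)`-exponential coordinate representation `(U, θ, T, c, ψ)`, with `U = θ.source`. -/
structure ExpCoordRep [TopologicalSpace X] (G : Gauge) (n : ℕ) {M : Type*} [TopologicalSpace M]
    [ChartedSpace (Model n) M] (e : M → X → ℝ) where
  θ : OpenPartialHomeomorph M (Model n)
  T : X → Model n
  c : X → ℝ
  ψ : M → ℝ
  isCoordSystem : IsCoordSystem θ
  continuous_T : Continuous T
  continuous_c : Continuous c
  smooth_ψ : ContMDiffOn 𝓘(ℝ, Model n) 𝓘(ℝ, ℝ) ∞ ψ θ.source
  repr : ∀ p ∈ θ.source, ∀ x, (e p x : EReal) = G.expFn (inner ℝ (θ p) (T x) - c x - ψ p)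

/-- The representation is global: `U = M`. -/
def ExpCoordRep.IsGlobal [TopologicalSpace X] {G : Gauge} {e : M → X → ℝ}
    (R : ExpCoordRep G n e) : Prop :=
  R.θ.source = univ

/-- `M` is an `(h, τ)`-exponential family in `𝒫_I(μ)`: a statistical model in `𝒫_I(μ)` in which
each point has an `(h, τ)`-exponential coordinate representation. -/
structure IsExpFamily [TopologicalSpace X] (G : Gauge) (n : ℕ) {M : Type*} [TopologicalSpace M]
    [ChartedSpace (Model n) M] [IsManifold 𝓘(ℝ, Model n) ∞ M] (μ : Measure X)
    (e : M → X → ℝ) : Prop where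
  isStatisticalModel : IsStatisticalModel n μ e
  mem_I : ∀ p, ∀ᵐ x ∂μ, e p x ∈ G.I
  exists_rep : ∀ p : M, ∃ R : ExpCoordRep G n e, p ∈ R.θ.source

/-! ### The geometry induced by the `(h, τ)`-divergence -/

/-- The function `d ∘ (e_x, e_x)` on `M × M`. -/
def dEval (G : Gauge) (e : M → X → ℝ) (x : X) : M → M → ℝ :=
  fun q r => G.d (e q x) (e r x)

/-- `- ∫ Ṽ_{(p,p)}(Ŵ (d ∘ (e_x, e_x))) dμ(x)`, the expression defining `g_p(V, W)`. -/
def metricExpr (G : Gauge) (μ : Measure X) (e : M → X → ℝ) (V W : VField n M) (p : M) : ℝ :=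
  - ∫ x, lieFst V (lieSnd W (dEval G e x)) p p ∂μ

/-- `- ∫ Ẑ_{(p,p)}(V̂ W̃ (d ∘ (e_x, e_x))) dμ(x)`, the expression defining `g_p(∇_Z V, W)`. -/
def connExpr (G : Gauge) (μ : Measure X) (e : M → X → ℝ) (Z V W : VField n M) (p : M) : ℝ :=
  - ∫ x, lieSnd Z (lieSnd V (lieFst W (dEval G e x))) p p ∂μ

/-- `M` is `(h, τ)`-compatible: the integrals in the two expressions above exist and are smooth
functions of the point. -/
structure IsCompatible (G : Gauge) (n : ℕ) {M : Type*} [TopologicalSpace M]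
    [ChartedSpace (Model n) M] [IsManifold 𝓘(ℝ, Model n) ∞ M] (μ : Measure X)
    (e : M → X → ℝ) : Prop where
  integrable_metric : ∀ (V W : VField n M) (p : M),
    Integrable (fun x => lieFst V (lieSnd W (dEval G e x)) p p) μ
  integrable_conn : ∀ (Z V W : VField n M) (p : M),
    Integrable (fun x => lieSnd Z (lieSnd V (lieFst W (dEval G e x))) p p) μ
  smooth_metric : ∀ V W : VField n M, IsSmooth n (metricExpr G μ e V W)
  smooth_conn : ∀ Z V W : VField n M, IsSmooth n (connExpr G μ e Z V W)

/-- `(g, ∇) = (g^{h,τ}, ∇^{h,τ})`: the smooth Riemannian metric and the smooth connection defined by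
the `(h, τ)`-divergence. -/
structure IsInduced (G : Gauge) (μ : Measure X) (e : M → X → ℝ) (g : Metric n M)
    (nabla : Conn n M) : Prop where
  smooth : CovariantDerivative.ContMDiffCovariantDerivative nabla ∞
  metric_eq : ∀ (V W : VField n M) (p : M), g.inner p (V p) (W p) = metricExpr G μ e V W p
  conn_eq : ∀ (Z V W : VField n M) (p : M),
    g.inner p (nabla.along Z V p) (W p) = connExpr G μ e Z V W p

end Model

end InfoGeo

end

open InfoGeo

noncomputable section

namespace InfoGeo

/-! ### Calculus of `τ`, `ℓ`, `χ`, `s⋆` and of the divergence integrand -/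

namespace Gauge

variable (G : Gauge)

/-! Everything is computed for `u = ℓ ∘ e_x`, which in a representation is `⟨θ, T(x)⟩ - c(x) - ψ`:
affine in the coordinates apart from a normalization that does not depend on `x`. Let `∇⁰` be the
flat connection of a global `θ` and `ρ = τ'/ℓ'`.

Since `d(t, s) = h(τ(t)) - s⋆(s) - τ(t) ℓ(s)`, mixed derivatives see only the last term. Hence `g(V,
W) = ∫ ρ Vu Wu` and `g(∇_Z V, W) = ∫ ρ Wu Z(Vu)`. Inserting `Z(Vu) = (∇⁰_Z V)u - Hess ψ(Z, V)` and
`∫ ρ Wu = W(𝕀_τ)` gives the central identity `∇_Z V = ∇⁰_Z V - Hess ψ(Z, V) grad 𝕀_τ`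
(`connExpr_eq_metricExpr`, `exists_isInduced`). It constructs the connection, and it shows `∇ = ∇⁰`
when `𝕀_τ` is constant. Conversely, if `θ` is affine and `V(𝕀_τ) ≠ 0` at a point for a coordinate
field `V`, then `Hess ψ(V, V) = 0` there. So `V(V e_x) = χ'χ (Vu)²`, whose integral vanishes; with
`χ' > 0` this forces `V = 0`, a contradiction (`II_tau_eq_of_isAffineCoord`).

Global representations rest on the linear independence of `1` and the components of `T`
(`eq_zero_of_inner_ae_eq`), which also makes `g` definite. The span of these functions is the same
for overlapping representations, hence for all of them by connectedness. Expanding `ℓ(e_q) -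
ℓ(e_{p₀})` in one fixed such basis yields global coordinates; they are injective because two
probability densities cannot be strictly ordered everywhere (`exists_isGlobal`).

For the Hessian structure, `s⋆' = -τ ℓ'` gives `V(W s⋆) = (∇⁰_V W) s⋆ - ρ Vu Wu + τ Hess ψ(V, W)`,
and integration identifies the potential (`isPotentialOn`). Rewriting `d` through `s⋆` and `u` turns
the divergence into the first order Taylor remainder of this potential (`divergence_eq`). Two affine
coordinate systems differ by an affine map and two potentials by an affine function, neither of
which changes that remainder (`IsAffineCoord.frame_sub_eq`, `IsPotentialOn.sub_eq`). -/

lemma differentiableAt_τ {t : ℝ} (ht : t ∈ G.I) : DifferentiableAt ℝ G.τ t :=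
  (G.smooth_τ.contDiffAt (G.isOpen_I.mem_nhds ht)).differentiableAt (by simp)

lemma convex_I : Convex ℝ G.I := G.ordConnected_I.convex

/-- The inverse function theorem applies because `τ' ≠ 0`. Openness makes `deriv G.h` on `τ(I)`
independent of the irrelevant values of `h` elsewhere. -/
lemma isOpen_image_τ : IsOpen (G.τ '' G.I) := by
  rw [isOpen_iff_mem_nhds]
  rintro _ ⟨t, ht, rfl⟩
  have h : HasStrictDerivAt G.τ (deriv G.τ t) t :=
    (G.smooth_τ.contDiffAt (G.isOpen_I.mem_nhds ht)).hasStrictDerivAt (by simp)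
  rw [← h.map_nhds_eq (G.deriv_τ_pos t ht).ne']
  exact image_mem_map (G.isOpen_I.mem_nhds ht)

lemma convex_image_τ : Convex ℝ (G.τ '' G.I) := by
  have := G.ordConnected_I.isPreconnected.image G.τ G.smooth_τ.continuousOn
  exact this.ordConnected.convex

lemma contDiffOn_deriv_h : ContDiffOn ℝ ∞ (deriv G.h) (G.τ '' G.I) :=
  G.smooth_h.deriv_of_isOpen G.isOpen_image_τ (by simp)

lemma contDiffOn_ell : ContDiffOn ℝ ∞ G.ell G.I :=
  G.contDiffOn_deriv_h.comp G.smooth_τ (mapsTo_image _ _)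

lemma differentiableAt_h {t : ℝ} (ht : t ∈ G.I) : DifferentiableAt ℝ G.h (G.τ t) :=
  (G.smooth_h.contDiffAt (G.isOpen_image_τ.mem_nhds ⟨t, ht, rfl⟩)).differentiableAt (by simp)

lemma differentiableAt_ell {t : ℝ} (ht : t ∈ G.I) : DifferentiableAt ℝ G.ell t :=
  (G.contDiffOn_ell.contDiffAt (G.isOpen_I.mem_nhds ht)).differentiableAt (by simp)

lemma deriv_ell_pos {t : ℝ} (ht : t ∈ G.I) : 0 < deriv G.ell t := by
  have h1 : DifferentiableAt ℝ (deriv G.h) (G.τ t) :=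
    (G.contDiffOn_deriv_h.contDiffAt
      (G.isOpen_image_τ.mem_nhds ⟨t, ht, rfl⟩)).differentiableAt (by simp)
  have h2 : deriv G.ell t = deriv (deriv G.h) (G.τ t) * deriv G.τ t :=
    deriv_comp t h1 (G.differentiableAt_τ ht)
  have h3 := G.deriv2_h_pos _ ⟨t, ht, rfl⟩
  rw [iteratedDeriv_succ, iteratedDeriv_one] at h3
  rw [h2]
  exact mul_pos h3 (G.deriv_τ_pos t ht)

lemma strictMonoOn_ell : StrictMonoOn G.ell G.I :=
  strictMonoOn_of_deriv_pos G.convex_I G.contDiffOn_ell.continuousOn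
    fun _ ht => G.deriv_ell_pos (interior_subset ht)

lemma contDiffOn_deriv_ell : ContDiffOn ℝ ∞ (deriv G.ell) G.I :=
  G.contDiffOn_ell.deriv_of_isOpen G.isOpen_I (by simp)

lemma contDiffOn_chi : ContDiffOn ℝ ∞ G.chi G.I :=
  contDiffOn_const.div G.contDiffOn_deriv_ell fun _ ht => (G.deriv_ell_pos ht).ne'

lemma chi_pos {t : ℝ} (ht : t ∈ G.I) : 0 < G.chi t :=
  one_div_pos.2 (G.deriv_ell_pos ht)

lemma contDiffOn_h_comp : ContDiffOn ℝ ∞ (fun t => G.h (G.τ t)) G.I :=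
  G.smooth_h.comp G.smooth_τ (mapsTo_image _ _)

lemma contDiffOn_sStar : ContDiffOn ℝ ∞ G.sStar G.I :=
  (G.smooth_τ.neg.mul G.contDiffOn_ell).add G.contDiffOn_h_comp

/-- The two terms `τ' · h'(τ)` cancel, as for a Legendre transform. -/
lemma deriv_sStar {t : ℝ} (ht : t ∈ G.I) : deriv G.sStar t = - G.τ t * deriv G.ell t := by
  have h1 := (G.differentiableAt_τ ht).hasDerivAt
  have h2 := (G.differentiableAt_ell ht).hasDerivAt
  have h3 : HasDerivAt (fun t => G.h (G.τ t)) (deriv G.h (G.τ t) * deriv G.τ t) t :=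
    (G.differentiableAt_h ht).hasDerivAt.comp t h1
  have h4 := (h1.neg.mul h2).add h3
  refine h4.deriv.trans ?_
  simp only [ell, Pi.neg_apply]
  ring

/-- The `(h, τ)`-divergence integrand with its variables separated. -/
lemma d_eq (t s : ℝ) : G.d t s = G.h (G.τ t) - G.sStar s - G.τ t * G.ell s := by
  simp only [d, sStar, ell]
  ring

/-- The form suited to integration: besides `ℓ`, it involves only `s⋆` and `τ`, the functions whose
integrals are assumed to exist. -/
lemma d_eq_sStar (t s : ℝ) :
    G.d t s = G.sStar t - G.sStar s + G.τ t * (G.ell t - G.ell s) := by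
  simp only [d, sStar, ell]
  ring

/-- The convex function `h` lies above its tangent line at `τ(s)`. -/
lemma d_nonneg {t s : ℝ} (ht : t ∈ G.I) (hs : s ∈ G.I) : 0 ≤ G.d t s := by
  have hc : ConvexOn ℝ (G.τ '' G.I) G.h := by
    refine convexOn_of_deriv2_nonneg' G.convex_image_τ
      (G.smooth_h.differentiableOn (by simp))
      (G.contDiffOn_deriv_h.differentiableOn (by simp)) fun r hr => ?_
    have := G.deriv2_h_pos r hr
    rw [iteratedDeriv_eq_iterate] at this
    exact this.le
  have htI : G.τ t ∈ G.τ '' G.I := ⟨t, ht, rfl⟩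
  have hsI : G.τ s ∈ G.τ '' G.I := ⟨s, hs, rfl⟩
  have hd := G.differentiableAt_h hs
  rw [d]
  rcases lt_trichotomy (G.τ s) (G.τ t) with h | h | h
  · have := hc.deriv_le_slope hsI htI h hd
    rw [slope_def_field, le_div_iff₀ (by linarith)] at this
    linarith
  · simp [h]
  · have := hc.slope_le_deriv htI hsI h hd
    rw [slope_def_field, div_le_iff₀ (by linarith)] at this
    linarith

lemma expFn_ell {t : ℝ} (ht : t ∈ G.I) : G.expFn (G.ell t) = (t : EReal) := by
  rw [expFn, if_pos (mem_image_of_mem _ ht),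
    G.strictMonoOn_ell.injOn.leftInvOn_invFunOn ht]

/-- Positivity excludes the value `0` and finiteness excludes `⊤`, so only the branch of the true
inverse remains. -/
lemma mem_and_ell_eq_of_expFn_eq {t u : ℝ} (ht : 0 < t) (h : (t : EReal) = G.expFn u) :
    t ∈ G.I ∧ G.ell t = u := by
  rw [expFn] at h
  split_ifs at h with h1 h2
  · obtain rfl := EReal.coe_injective h
    exact ⟨Function.invFunOn_mem h1, Function.invFunOn_eq h1⟩
  · exact absurd (EReal.coe_eq_zero.1 h) ht.ne'
  · exact absurd h (EReal.coe_ne_top t)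

end Gauge

/-! ### Exponential representations on the `ℓ`-scale -/

section Rep

variable {X : Type*} [TopologicalSpace X] {n : ℕ} {M : Type*}
  [TopologicalSpace M] [ChartedSpace (Model n) M] {G : Gauge} {e : M → X → ℝ}

/-- A representation upgrades membership in `I` from almost every `x` to every `x`. -/
lemma ExpCoordRep.mem_I (R : ExpCoordRep G n e) (hpos : ∀ p x, 0 < e p x) {p : M}
    (hp : p ∈ R.θ.source) (x : X) : e p x ∈ G.I :=
  (G.mem_and_ell_eq_of_expFn_eq (hpos p x) (R.repr p hp x)).1

lemma ExpCoordRep.ell_eq (R : ExpCoordRep G n e) (hpos : ∀ p x, 0 < e p x) {p : M}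
    (hp : p ∈ R.θ.source) (x : X) :
    G.ell (e p x) = inner ℝ (R.θ p) (R.T x) - R.c x - R.ψ p :=
  (G.mem_and_ell_eq_of_expFn_eq (hpos p x) (R.repr p hp x)).2

end Rep

/-! ### Derivatives of functions along vector fields -/

section Calculus

variable {n : ℕ} {M : Type*} [TopologicalSpace M] [ChartedSpace (Model n) M]
  {F F' : Type*} [NormedAddCommGroup F] [NormedSpace ℝ F]
  [NormedAddCommGroup F'] [NormedSpace ℝ F']

/-- Smooth maps from `M` to a normed space. -/
abbrev IsSmoothMap (n : ℕ) {M : Type*} [TopologicalSpace M] [ChartedSpace (Model n) M]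
    {F : Type*} [NormedAddCommGroup F] [NormedSpace ℝ F] (f : M → F) : Prop :=
  ContMDiff 𝓘(ℝ, Model n) 𝓘(ℝ, F) ∞ f

/-- Maps from `M` to a normed space that are differentiable at `p`. -/
abbrev IsDiffAt (n : ℕ) {M : Type*} [TopologicalSpace M] [ChartedSpace (Model n) M]
    {F : Type*} [NormedAddCommGroup F] [NormedSpace ℝ F] (f : M → F) (p : M) : Prop :=
  MDifferentiableAt 𝓘(ℝ, Model n) 𝓘(ℝ, F) f p

lemma mvfderiv_comp_apply_of_differentiableAt {f : M → F} {g : F → F'} {p : M}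
    (hg : DifferentiableAt ℝ g (f p)) (hf : IsDiffAt n f p)
    (v : TangentSpace 𝓘(ℝ, Model n) p) :
    mvfderiv 𝓘(ℝ, Model n) (fun q => g (f q)) p v
      = fderiv ℝ g (f p) (mvfderiv 𝓘(ℝ, Model n) f p v) := by
  have h := mfderiv_comp_apply p hg.mdifferentiableAt hf v
  rw [mfderiv_eq_fderiv] at h
  exact h

lemma mvfderiv_congr {f g : M → F} {p : M} (h : f =ᶠ[𝓝 p] g) :
    mvfderiv 𝓘(ℝ, Model n) f p = mvfderiv 𝓘(ℝ, Model n) g p := by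
  have h1 := h.mfderiv_eq (I := 𝓘(ℝ, Model n)) (I' := 𝓘(ℝ, F))
  have h2 := h.self_of_nhds
  ext v
  exact congrArg (fun L => L v) h1

lemma mvfderiv_clm_apply (L : F →L[ℝ] F') {f : M → F} {p : M}
    (hf : IsDiffAt n f p) (v : TangentSpace 𝓘(ℝ, Model n) p) :
    mvfderiv 𝓘(ℝ, Model n) (fun q => L (f q)) p v = L (mvfderiv 𝓘(ℝ, Model n) f p v) := by
  rw [mvfderiv_comp_apply_of_differentiableAt L.differentiableAt hf, L.fderiv]

lemma IsSmoothMap.isDiffAt {f : M → F} (hf : IsSmoothMap n f) (p : M) : IsDiffAt n f p :=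
  ContMDiff.mdifferentiableAt hf (by simp)

lemma IsSmooth.isDiffAt {f : M → ℝ} (hf : IsSmooth n f) (p : M) :
    IsDiffAt n f p :=
  ContMDiff.mdifferentiableAt hf (by simp)

lemma IsSmooth.comp_of_contDiffOn {f : M → ℝ} (hf : IsSmooth n f) {φ : ℝ → ℝ} {s : Set ℝ}
    (hs : IsOpen s) (hφ : ContDiffOn ℝ ∞ φ s) (hfs : ∀ p, f p ∈ s) :
    IsSmooth n (fun p => φ (f p)) := fun p =>
  ContDiffAt.comp_contMDiffAt (g := φ) (f := f) (x := p)
    (hφ.contDiffAt (hs.mem_nhds (hfs p))) (hf p)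

lemma lieD_comp (V : ∀ p : M, TangentSpace 𝓘(ℝ, Model n) p) {f : M → ℝ} {φ : ℝ → ℝ} {p : M}
    (hφ : DifferentiableAt ℝ φ (f p)) (hf : IsDiffAt n f p) :
    lieD V (fun q => φ (f q)) p = deriv φ (f p) * lieD V f p := by
  rw [lieD, mvfderiv_comp_apply_of_differentiableAt hφ hf, lieD, fderiv_eq_smul_deriv]
  simp [mul_comm]

lemma lieD_sub (V : ∀ p : M, TangentSpace 𝓘(ℝ, Model n) p) {f g : M → ℝ} {p : M}
    (hf : IsDiffAt n f p)
    (hg : IsDiffAt n g p) :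
    lieD V (fun q => f q - g q) p = lieD V f p - lieD V g p := by
  simp only [lieD]
  rw [mvfderiv_fun_sub hf hg]
  rfl

lemma lieD_neg (V : ∀ p : M, TangentSpace 𝓘(ℝ, Model n) p) (f : M → ℝ) (p : M) :
    lieD V (fun q => - f q) p = - lieD V f p := by
  simp only [lieD]
  rw [mvfderiv_fun_neg]
  rfl

lemma lieD_mul (V : ∀ p : M, TangentSpace 𝓘(ℝ, Model n) p) {f g : M → ℝ} {p : M}
    (hf : IsDiffAt n f p)
    (hg : IsDiffAt n g p) :
    lieD V (fun q => f q * g q) p = f p * lieD V g p + g p * lieD V f p := by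
  simp only [lieD]
  rw [mvfderiv_fun_mul hf hg]
  rfl

lemma lieD_const (V : ∀ p : M, TangentSpace 𝓘(ℝ, Model n) p) (c : ℝ) (p : M) :
    lieD V (fun _ => c) p = 0 := by
  simp only [lieD]
  rw [mvfderiv_const]
  rfl

lemma lieD_const_mul (V : ∀ p : M, TangentSpace 𝓘(ℝ, Model n) p) (c : ℝ) {f : M → ℝ} {p : M}
    (hf : IsDiffAt n f p) :
    lieD V (fun q => c * f q) p = c * lieD V f p := by
  rw [lieD_mul V mdifferentiableAt_const hf, lieD_const, mul_zero, add_zero]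

lemma lieD_inner_const {F : Type*} [NormedAddCommGroup F] [InnerProductSpace ℝ F]
    (V : ∀ p : M, TangentSpace 𝓘(ℝ, Model n) p) {f : M → F} {p : M}
    (hf : IsDiffAt n f p) (b : F) :
    lieD V (fun q => inner ℝ (f q) b) p = inner ℝ (mvfderiv 𝓘(ℝ, Model n) f p (V p)) b := by
  have := mvfderiv_clm_apply (innerSL ℝ b) hf (V p)
  simp only [innerSL_apply_apply] at this
  simpa only [real_inner_comm, lieD] using this

variable [IsManifold 𝓘(ℝ, Model n) ∞ M]

/-- The function is the fibre component of the smooth tangent map of `f` composed with the section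
`V`. -/
lemma contMDiffAt_mvfderiv_apply {f : M → F} {p : M}
    (hf : IsSmoothMap n f)
    {V : ∀ p : M, TangentSpace 𝓘(ℝ, Model n) p}
    (hV : ContMDiffAt 𝓘(ℝ, Model n) 𝓘(ℝ, Model n).tangent ∞
      (fun q => (⟨q, V q⟩ : TangentBundle 𝓘(ℝ, Model n) M)) p) :
    ContMDiffAt 𝓘(ℝ, Model n) 𝓘(ℝ, F) ∞ (fun q => mvfderiv 𝓘(ℝ, Model n) f q (V q)) p := by
  have h1 : ContMDiff 𝓘(ℝ, Model n).tangent 𝓘(ℝ, F).tangent ∞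
      (tangentMap 𝓘(ℝ, Model n) 𝓘(ℝ, F) f) := hf.contMDiff_tangentMap (by simp)
  have h2 := (contMDiff_snd_tangentBundle_modelSpace F 𝓘(ℝ, F) (n := ∞)).comp h1
  exact h2.contMDiffAt.comp p hV

lemma contMDiff_mvfderiv_apply {f : M → F} (hf : IsSmoothMap n f)
    (V : VField n M) :
    IsSmoothMap n (fun q => mvfderiv 𝓘(ℝ, Model n) f q (V q)) :=
  fun p => contMDiffAt_mvfderiv_apply hf (V.contMDiff p)

lemma IsSmooth.lieD {f : M → ℝ} (hf : IsSmooth n f) (V : VField n M) : IsSmooth n (lieD V f) :=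
  contMDiff_mvfderiv_apply hf V

end Calculus

/-! ### Constant vector fields and maps to the model space with invertible differential -/

section ModelSpace

variable {E : Type*} [NormedAddCommGroup E] [NormedSpace ℝ E]

lemma contMDiff_const_field (a : E) : ContMDiff 𝓘(ℝ, E) 𝓘(ℝ, E).tangent ∞
    (fun y : E => (⟨y, a⟩ : TangentBundle 𝓘(ℝ, E) E)) := by
  have : ContDiff ℝ ∞ (fun _ : E => a) := contDiff_const
  exact contMDiff_vectorSpace_iff_contDiff.2 this

lemma mlieBracket_const (a b : E) (y : E) :
    VectorField.mlieBracket 𝓘(ℝ, E) (fun _ : E => a) (fun _ : E => b) y = 0 := by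
  have h := congrFun (VectorField.mlieBracketWithin_eq_lieBracketWithin (𝕜 := ℝ)
    (V := fun _ : E => a) (W := fun _ : E => b) (s := univ)) y
  have h2 : VectorField.lieBracketWithin ℝ (fun _ : E => a) (fun _ : E => b) univ y = 0 := by
    rw [VectorField.lieBracketWithin_univ]
    simp [VectorField.lieBracket]
  exact h.trans h2

end ModelSpace

section Etale

variable {n : ℕ} {M : Type*} [TopologicalSpace M] [ChartedSpace (Model n) M]

/-- Smooth maps to the model space with invertible differential. -/
structure IsEtale (θ : M → Model n) : Prop where
  smooth : IsSmoothMap n θ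
  isInvertible : ∀ p, (mvfderiv 𝓘(ℝ, Model n) θ p).IsInvertible

namespace IsEtale

variable {θ : M → Model n}

lemma apply_inverse (hθ : IsEtale θ) (p : M) (a : Model n) :
    mvfderiv 𝓘(ℝ, Model n) θ p ((mvfderiv 𝓘(ℝ, Model n) θ p).inverse a) = a :=
  (hθ.isInvertible p).self_apply_inverse a

lemma inverse_apply (hθ : IsEtale θ) (p : M) (v : TangentSpace 𝓘(ℝ, Model n) p) :
    (mvfderiv 𝓘(ℝ, Model n) θ p).inverse (mvfderiv 𝓘(ℝ, Model n) θ p v) = v :=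
  (hθ.isInvertible p).inverse_apply_self v

lemma ext_of_mvfderiv (hθ : IsEtale θ) {p : M} {v w : TangentSpace 𝓘(ℝ, Model n) p}
    (h : mvfderiv 𝓘(ℝ, Model n) θ p v = mvfderiv 𝓘(ℝ, Model n) θ p w) : v = w := by
  rw [← hθ.inverse_apply p v, h, hθ.inverse_apply]

variable [IsManifold 𝓘(ℝ, Model n) ∞ M]

/-- The field is the pullback along `θ` of a constant vector field. -/
lemma contMDiff_inverse_const (hθ : IsEtale θ) (a : Model n) :
    ContMDiff 𝓘(ℝ, Model n) 𝓘(ℝ, Model n).tangent ∞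
      (fun q => (⟨q, (mvfderiv 𝓘(ℝ, Model n) θ q).inverse a⟩ : TangentBundle 𝓘(ℝ, Model n) M)) :=
  (contMDiff_const_field a).mpullback_vectorField hθ.smooth hθ.isInvertible (by simp)

/-- The vector field with components `w` in the coordinates `θ`. -/
def field (hθ : IsEtale θ) (w : M → Model n) (hw : IsSmoothMap n w) : VField n M where
  toFun q := (mvfderiv 𝓘(ℝ, Model n) θ q).inverse (w q)
  contMDiff_toFun := by
    have h : ∀ i : Fin n, IsSmoothMap n (fun q => w q i) := fun i =>
      (EuclideanSpace.proj (𝕜 := ℝ) i).contMDiff.comp hw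
    have h2 := ContMDiff.sum_section (s := Finset.univ) fun i _ =>
      (h i).smul_section (hθ.contMDiff_inverse_const (EuclideanSpace.single i 1))
    convert h2 using 3 with q
    simp only [Pi.smul_apply', ← map_smul, ← map_sum]
    congr 1
    ext j
    simp [Finset.sum_apply, Pi.single_apply]

/-- The vector field with constant components `a` in the coordinates `θ`. -/
def frame (hθ : IsEtale θ) (a : Model n) : VField n M := hθ.field (fun _ => a) contMDiff_const

lemma mvfderiv_field (hθ : IsEtale θ) {w : M → Model n} (hw : IsSmoothMap n w) (p : M) :
    mvfderiv 𝓘(ℝ, Model n) θ p (hθ.field w hw p) = w p :=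
  hθ.apply_inverse p (w p)

lemma mvfderiv_frame (hθ : IsEtale θ) (a : Model n) (p : M) :
    mvfderiv 𝓘(ℝ, Model n) θ p (hθ.frame a p) = a :=
  hθ.apply_inverse p a

lemma frame_apply (hθ : IsEtale θ) (a : Model n) (p : M) :
    hθ.frame a p = (mvfderiv 𝓘(ℝ, Model n) θ p).inverse a := rfl

lemma frame_mvfderiv (hθ : IsEtale θ) {p : M} (v : TangentSpace 𝓘(ℝ, Model n) p) :
    hθ.frame (mvfderiv 𝓘(ℝ, Model n) θ p v) p = v := hθ.inverse_apply p v

/-- Pullback respects Lie brackets, and constant fields on the model space commute. -/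
lemma mlieBracket_frame (hθ : IsEtale θ) (a b : Model n) (p : M) :
    VectorField.mlieBracket 𝓘(ℝ, Model n) (hθ.frame a) (hθ.frame b) p = 0 := by
  have hmin : minSmoothness ℝ 2 ≤ (∞ : WithTop ℕ∞) := by
    rw [minSmoothness_of_isRCLikeNormedField]
    exact WithTop.coe_le_coe.2 le_top
  have : IsManifold 𝓘(ℝ, Model n) (minSmoothness ℝ 2) M := IsManifold.of_le hmin
  have h := VectorField.mpullback_mlieBracket (I := 𝓘(ℝ, Model n)) (I' := 𝓘(ℝ, Model n))
    (f := θ) (x₀ := p) (n := ∞) (V := fun _ => a) (W := fun _ => b)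
    ((contMDiff_const_field a).mdifferentiableAt (by simp))
    ((contMDiff_const_field b).mdifferentiableAt (by simp)) hθ.smooth.contMDiffAt hmin
  refine h.symm.trans ?_
  rw [VectorField.mpullback_apply]
  have := mlieBracket_const a b (θ p)
  exact (congrArg _ this).trans (map_zero _)

end IsEtale

end Etale

/-! ### Smoothness of bundle homomorphisms tested on a frame -/

section Bundle

variable {E : Type*} [NormedAddCommGroup E] [NormedSpace ℝ E] [FiniteDimensional ℝ E]
  {n : ℕ} {M : Type*} [TopologicalSpace M] [ChartedSpace (Model n) M]
  {F : Type*} [NormedAddCommGroup F] [NormedSpace ℝ F]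

lemma contMDiffAt_clm_of_apply {p : M} {φ : M → E →L[ℝ] F}
    (h : ∀ a, ContMDiffAt 𝓘(ℝ, Model n) 𝓘(ℝ, F) ∞ (fun q => φ q a) p) :
    ContMDiffAt 𝓘(ℝ, Model n) 𝓘(ℝ, E →L[ℝ] F) ∞ φ p := by
  let b := Module.finBasis ℝ E
  have hφ : φ = fun q => ∑ i, (ContinuousLinearMap.smulRightL ℝ E F
      (LinearMap.toContinuousLinearMap (b.coord i))) (φ q (b i)) := by
    ext q v
    conv_lhs => rw [← b.sum_repr v, map_sum]
    simp
  rw [hφ]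
  refine contMDiffAt_finsetSum fun i _ => ?_
  exact (ContinuousLinearMap.contMDiff _).contMDiffAt.comp p (h (b i))

variable [IsManifold 𝓘(ℝ, Model n) ∞ M]
  {V : M → Type*} [TopologicalSpace (Bundle.TotalSpace F V)]
  [∀ x, AddCommGroup (V x)] [∀ x, Module ℝ (V x)] [∀ x, TopologicalSpace (V x)]
  [∀ x, IsTopologicalAddGroup (V x)] [∀ x, ContinuousSMul ℝ (V x)]
  [FiberBundle F V] [VectorBundle ℝ F V]

/-- A section of `Hom(TM, V)` is smooth if its values on a frame of constant vector fields are. -/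
lemma IsEtale.contMDiff_hom {θ : M → Model n} (hθ : IsEtale θ)
    {φ : ∀ p : M, TangentSpace 𝓘(ℝ, Model n) p →L[ℝ] V p}
    (h : ∀ i, ContMDiff 𝓘(ℝ, Model n) (𝓘(ℝ, Model n).prod 𝓘(ℝ, F)) ∞
      (fun q => (⟨q, φ q (hθ.frame (EuclideanSpace.single i 1) q)⟩ : Bundle.TotalSpace F V))) :
    ContMDiff 𝓘(ℝ, Model n) (𝓘(ℝ, Model n).prod 𝓘(ℝ, Model n →L[ℝ] F)) ∞
      (fun q => Bundle.TotalSpace.mk' (Model n →L[ℝ] F)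
        (E := fun x => TangentSpace 𝓘(ℝ, Model n) x →L[ℝ] V x) q (φ q)) := by
  intro p
  refine (contMDiffAt_hom_bundle _).2 ⟨contMDiffAt_id, contMDiffAt_clm_of_apply fun a => ?_⟩
  let t := trivializationAt (Model n) (TangentSpace 𝓘(ℝ, Model n) : M → Type _) p
  let W : ∀ q : M, TangentSpace 𝓘(ℝ, Model n) q := fun q => t.symm q a
  have hW : ContMDiffAt 𝓘(ℝ, Model n) 𝓘(ℝ, Model n).tangent ∞
      (fun q => (⟨q, W q⟩ : TangentBundle 𝓘(ℝ, Model n) M)) p := by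
    rw [Bundle.contMDiffAt_section]
    refine (contMDiffAt_const (c := a)).congr_of_eventuallyEq ?_
    filter_upwards [t.open_baseSet.mem_nhds (FiberBundle.mem_baseSet_trivializationAt' p)]
      with q hq
    exact congrArg Prod.snd (t.apply_mk_symm hq a)
  have hc := contMDiffAt_mvfderiv_apply hθ.smooth hW
  have hc' : ∀ i : Fin n, ContMDiffAt 𝓘(ℝ, Model n) 𝓘(ℝ, ℝ) ∞
      (fun q => mvfderiv 𝓘(ℝ, Model n) θ q (W q) i) p := fun i =>
    ((EuclideanSpace.proj (𝕜 := ℝ) i).contMDiff).contMDiffAt.comp p hc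
  have hs := ContMDiffAt.sum_section (s := Finset.univ) fun i _ =>
    (hc' i).smul_section (h i p)
  have hW2 : ∀ q, φ q (W q) = ∑ i, mvfderiv 𝓘(ℝ, Model n) θ q (W q) i •
      φ q (hθ.frame (EuclideanSpace.single i 1) q) := fun q => by
    simp only [← map_smul, ← map_sum]
    congr 1
    refine hθ.ext_of_mvfderiv ?_
    simp only [map_sum, map_smul, hθ.mvfderiv_frame]
    ext j
    simp [Finset.sum_apply, Pi.single_apply]
  have hs2 := (Bundle.contMDiffAt_section p).1 hs
  refine hs2.congr_of_eventuallyEq ?_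
  filter_upwards [t.open_baseSet.mem_nhds (FiberBundle.mem_baseSet_trivializationAt' p),
    (trivializationAt F V p).open_baseSet.mem_nhds (FiberBundle.mem_baseSet_trivializationAt' p)]
    with q hq hq'
  simp only [Pi.smul_apply', ← hW2 q]
  rw [ContinuousLinearMap.inCoordinates_eq hq hq']
  simp [W, t]

end Bundle

/-! ### Differentials on connected manifolds and in global charts -/

section Chart

variable {n : ℕ} {M : Type*} [TopologicalSpace M] [ChartedSpace (Model n) M]
  {F : Type*} [NormedAddCommGroup F] [NormedSpace ℝ F]

lemma mvfderiv_finset_sum {ι : Type*} (s : Finset ι) {f : ι → M → F} {p : M}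
    (hf : ∀ i ∈ s, IsSmoothMap n (f i)) (v : TangentSpace 𝓘(ℝ, Model n) p) :
    mvfderiv 𝓘(ℝ, Model n) (fun q => ∑ i ∈ s, f i q) p v
      = ∑ i ∈ s, mvfderiv 𝓘(ℝ, Model n) (f i) p v := by
  classical
  induction s using Finset.induction_on with
  | empty =>
    simp only [Finset.sum_empty]
    rw [mvfderiv_const]
    rfl
  | insert i s his ih =>
    simp only [Finset.sum_insert his]
    have h1 : IsSmoothMap n (fun q => ∑ i ∈ s, f i q) :=
      contMDiff_finsetSum fun j hj => hf j (Finset.mem_insert_of_mem hj)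
    rw [mvfderiv_fun_add ((hf i (Finset.mem_insert_self i s)).isDiffAt p) (h1.isDiffAt p),
      ← ih fun j hj => hf j (Finset.mem_insert_of_mem hj)]
    rfl

lemma mvfderiv_smul_apply {a : M → ℝ} {f : M → F} {p : M} (ha : IsSmoothMap n a)
    (hf : IsSmoothMap n f) (v : TangentSpace 𝓘(ℝ, Model n) p) :
    mvfderiv 𝓘(ℝ, Model n) (fun q => a q • f q) p v
      = a p • mvfderiv 𝓘(ℝ, Model n) f p v + mvfderiv 𝓘(ℝ, Model n) a p v • f p := by
  rw [mvfderiv_fun_smul (ha.isDiffAt p) (hf.isDiffAt p)]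
  rfl

/-- A smooth map with vanishing differential on a connected manifold is constant. -/
lemma eq_of_mvfderiv_eq_zero [ConnectedSpace M] [IsManifold 𝓘(ℝ, Model n) ∞ M]
    {f : M → F} (hf : IsSmoothMap n f)
    (h : ∀ (p : M) (v : TangentSpace 𝓘(ℝ, Model n) p), mvfderiv 𝓘(ℝ, Model n) f p v = 0)
    (p q : M) : f p = f q := by
  suffices IsLocallyConstant f from this.apply_eq_of_isPreconnected isPreconnected_univ
    (mem_univ p) (mem_univ q)
  rw [IsLocallyConstant.iff_eventually_eq]
  intro p
  let φ := chartAt (Model n) p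
  have hφ : ∀ y ∈ φ.target, HasFDerivAt (fun z => f (φ.symm z)) (0 : Model n →L[ℝ] F) y := by
    intro y hy
    have h1 : MDifferentiableAt 𝓘(ℝ, Model n) 𝓘(ℝ, Model n) φ.symm y :=
      mdifferentiableAt_atlas_symm (chart_mem_atlas _ p) hy
    have h2 := ((hf.isDiffAt (φ.symm y)).hasMFDerivAt.comp y h1.hasMFDerivAt)
    have h3 : HasFDerivAt (fun z => f (φ.symm z)) _ y := h2.hasFDerivAt
    refine h3.congr_fderiv (ContinuousLinearMap.ext fun v => ?_)
    exact h (φ.symm y) _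
  obtain ⟨r, hr, hball⟩ := Metric.isOpen_iff.1 φ.open_target (φ p) (mem_chart_target _ p)
  have hconst : ∀ y ∈ Metric.ball (φ p) r, f (φ.symm y) = f (φ.symm (φ p)) := fun y hy =>
    (convex_ball (φ p) r).is_const_of_fderivWithin_eq_zero (𝕜 := ℝ)
      (f := fun z => f (φ.symm z))
      (fun z hz => (hφ z (hball hz)).differentiableAt.differentiableWithinAt)
      (fun z hz => (hφ z (hball hz)).hasFDerivWithinAt.fderivWithin
        (Metric.isOpen_ball.uniqueDiffWithinAt hz)) hy (Metric.mem_ball_self hr)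
  have hcont : ContinuousAt φ p := φ.continuousAt (mem_chart_source _ p)
  filter_upwards [hcont (Metric.ball_mem_nhds _ hr), φ.open_source.mem_nhds (mem_chart_source _ p)]
    with q hq hqs
  have := hconst _ hq
  rwa [φ.left_inv hqs, φ.left_inv (mem_chart_source _ p)] at this

lemma IsCoordSystem.isInvertible {θ : OpenPartialHomeomorph M (Model n)} (h : IsCoordSystem θ)
    {p : M} (hp : p ∈ θ.source) : (mvfderiv 𝓘(ℝ, Model n) θ p).IsInvertible := by
  have h1 : θ.MDifferentiable 𝓘(ℝ, Model n) 𝓘(ℝ, Model n) :=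
    ⟨(contMDiffOn_of_mem_maximalAtlas h).mdifferentiableOn (by simp),
      (contMDiffOn_symm_of_mem_maximalAtlas h).mdifferentiableOn (by simp)⟩
  exact ⟨h1.mfderiv hp, rfl⟩

lemma IsCoordSystem.isEtale {θ : OpenPartialHomeomorph M (Model n)} (h : IsCoordSystem θ)
    (hs : θ.source = univ) : IsEtale θ where
  smooth := by
    have := contMDiffOn_of_mem_maximalAtlas h
    rw [hs] at this
    exact contMDiffOn_univ.1 this
  isInvertible p := h.isInvertible (hs ▸ mem_univ p)

variable [IsManifold 𝓘(ℝ, Model n) ∞ M]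

/-- Second derivatives along constant vector fields of a global chart are symmetric. -/
lemma IsCoordSystem.mvfderiv_frame_comm {θ : OpenPartialHomeomorph M (Model n)}
    (h : IsCoordSystem θ) (hs : θ.source = univ) {f : M → F} (hf : IsSmoothMap n f)
    (a b : Model n) (p : M) :
    mvfderiv 𝓘(ℝ, Model n)
        (fun q => mvfderiv 𝓘(ℝ, Model n) f q ((h.isEtale hs).frame a q)) p
        ((h.isEtale hs).frame b p)
      = mvfderiv 𝓘(ℝ, Model n)
        (fun q => mvfderiv 𝓘(ℝ, Model n) f q ((h.isEtale hs).frame b q)) p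
        ((h.isEtale hs).frame a p) := by
  have hθ := h.isEtale hs
  let g : Model n → F := fun y => f (θ.symm y)
  have hg : ∀ q, ContDiffAt ℝ ∞ g (θ q) := fun q => by
    have hq : θ q ∈ θ.target := θ.map_source (hs ▸ mem_univ q)
    exact (hf.contMDiffAt.comp (θ q) (contMDiffAt_symm_of_mem_maximalAtlas h hq)).contDiffAt
  have hfg : f = fun q => g (θ q) := by
    ext q
    simp only [g, θ.left_inv (hs ▸ mem_univ q : q ∈ θ.source)]
  have h1 : ∀ (a : Model n) (q : M), mvfderiv 𝓘(ℝ, Model n) f q ((h.isEtale hs).frame a q)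
      = fderiv ℝ g (θ q) a := fun a q => by
    rw [hfg, mvfderiv_comp_apply_of_differentiableAt ((hg q).differentiableAt (by simp))
      (hθ.smooth.isDiffAt q), hθ.mvfderiv_frame]
  have h2 : DifferentiableAt ℝ (fderiv ℝ g) (θ p) :=
    ((hg p).fderiv_right (m := 1) (by exact WithTop.coe_le_coe.2 le_top)).differentiableAt (by simp)
  have h3 : ∀ a b : Model n, mvfderiv 𝓘(ℝ, Model n)
      (fun q => mvfderiv 𝓘(ℝ, Model n) f q ((h.isEtale hs).frame a q)) p
        ((h.isEtale hs).frame b p) = fderiv ℝ (fderiv ℝ g) (θ p) b a := fun a b => by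
    simp only [h1 a]
    rw [mvfderiv_comp_apply_of_differentiableAt (g := fun y => fderiv ℝ g y a)
      (h2.clm_apply (differentiableAt_const a)) (hθ.smooth.isDiffAt p), hθ.mvfderiv_frame,
      fderiv_clm_apply h2 (differentiableAt_const a)]
    simp
  rw [h3, h3]
  exact (((hg p).of_le (by exact WithTop.coe_le_coe.2 le_top)).isSymmSndFDerivAt
    (n := 2) (by simp)) b a

end Chart

/-! ### The flat connection of global coordinates -/

section Flat

variable {n : ℕ} {M : Type*} [TopologicalSpace M] [ChartedSpace (Model n) M]
  [IsManifold 𝓘(ℝ, Model n) ∞ M] {F : Type*} [NormedAddCommGroup F] [NormedSpace ℝ F]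

namespace IsEtale

variable {θ : M → Model n}

/-- The axioms of a covariant derivative concern sections that are merely differentiable at a point,
so smoothness of `σ` cannot be assumed here. -/
lemma isDiffAt_components (hθ : IsEtale θ) {σ : ∀ p : M, TangentSpace 𝓘(ℝ, Model n) p} {p : M}
    (hσ : MDifferentiableAt 𝓘(ℝ, Model n) 𝓘(ℝ, Model n).tangent
      (fun q => (⟨q, σ q⟩ : TangentBundle 𝓘(ℝ, Model n) M)) p) :
    IsDiffAt n (fun q => mvfderiv 𝓘(ℝ, Model n) θ q (σ q)) p := by
  have h1 : ContMDiff 𝓘(ℝ, Model n).tangent 𝓘(ℝ, Model n).tangent ∞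
      (tangentMap 𝓘(ℝ, Model n) 𝓘(ℝ, Model n) θ) := hθ.smooth.contMDiff_tangentMap (by simp)
  have h2 := (contMDiff_snd_tangentBundle_modelSpace (Model n) 𝓘(ℝ, Model n) (n := ∞)).comp h1
  exact (h2.mdifferentiableAt (by simp)).comp p hσ

/-- The connection whose parallel vector fields are those with constant components. -/
def flatConn (hθ : IsEtale θ) : Conn n M where
  toFun σ p := (mvfderiv 𝓘(ℝ, Model n) θ p).inverse.comp
    (mvfderiv 𝓘(ℝ, Model n) (fun q => mvfderiv 𝓘(ℝ, Model n) θ q (σ q)) p)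
  isCovariantDerivativeOnUniv :=
    { add := fun {σ σ' p} hσ hσ' _ => by
        simp only [Pi.add_apply, map_add]
        rw [mvfderiv_fun_add (hθ.isDiffAt_components hσ) (hθ.isDiffAt_components hσ'),
          ContinuousLinearMap.comp_add]
      leibniz := fun {σ g p} hσ hg _ => by
        simp only [Pi.smul_apply', map_smul]
        rw [mvfderiv_fun_smul hg (hθ.isDiffAt_components hσ)]
        ext v
        have := hθ.inverse_apply p (σ p)
        simp [this] }

lemma mvfderiv_flatConn (hθ : IsEtale θ) (V W : ∀ p : M, TangentSpace 𝓘(ℝ, Model n) p) (p : M) :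
    mvfderiv 𝓘(ℝ, Model n) θ p (Conn.along hθ.flatConn V W p)
      = mvfderiv 𝓘(ℝ, Model n) (fun q => mvfderiv 𝓘(ℝ, Model n) θ q (W q)) p (V p) :=
  hθ.apply_inverse p _

/-- The vector field with components `V (W θ)`, that is, the flat covariant derivative. -/
def dfield (hθ : IsEtale θ) (V W : VField n M) : VField n M :=
  hθ.field _ (contMDiff_mvfderiv_apply (contMDiff_mvfderiv_apply hθ.smooth W) V)

lemma mvfderiv_dfield (hθ : IsEtale θ) (V W : VField n M) (p : M) :
    mvfderiv 𝓘(ℝ, Model n) θ p (hθ.dfield V W p)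
      = mvfderiv 𝓘(ℝ, Model n) (fun q => mvfderiv 𝓘(ℝ, Model n) θ q (W q)) p (V p) :=
  hθ.mvfderiv_field _ p

lemma flatConn_along (hθ : IsEtale θ) (V W : VField n M) (p : M) :
    Conn.along hθ.flatConn V W p = hθ.dfield V W p :=
  hθ.ext_of_mvfderiv (by rw [mvfderiv_flatConn, mvfderiv_dfield])

lemma dfield_frame (hθ : IsEtale θ) (V : VField n M) (a : Model n) (p : M) :
    hθ.dfield V (hθ.frame a) p = 0 := by
  refine hθ.ext_of_mvfderiv ?_
  rw [mvfderiv_dfield]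
  simp only [mvfderiv_frame]
  rw [mvfderiv_const, map_zero]
  rfl

/-- A connection all of whose covariant derivatives agree with the flat ones. -/
def IsParallel (hθ : IsEtale θ) (nabla : Conn n M) : Prop :=
  ∀ (Z V : VField n M) (p : M), nabla.along Z V p = hθ.dfield Z V p

/-- Torsion is tensorial, so it can be evaluated on frame fields; these are parallel and commute. -/
lemma IsParallel.torsion_eq_zero {hθ : IsEtale θ} {nabla : Conn n M} (h : hθ.IsParallel nabla)
    (p : M) : CovariantDerivative.torsion nabla p = 0 := by
  ext v w : 2
  have hs : ∀ a : Model n, MDifferentiableAt 𝓘(ℝ, Model n) 𝓘(ℝ, Model n).tangent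
      (fun q => (⟨q, hθ.frame a q⟩ : TangentBundle 𝓘(ℝ, Model n) M)) p := fun a =>
    (hθ.frame a).mdifferentiableAt
  have h0 := CovariantDerivative.torsion_apply nabla
    (hs (mvfderiv 𝓘(ℝ, Model n) θ p v)) (hs (mvfderiv 𝓘(ℝ, Model n) θ p w))
  rw [hθ.mlieBracket_frame] at h0
  rw [hθ.frame_mvfderiv v, hθ.frame_mvfderiv w] at h0
  rw [h0]
  have h1 := h (hθ.frame (mvfderiv 𝓘(ℝ, Model n) θ p v))
    (hθ.frame (mvfderiv 𝓘(ℝ, Model n) θ p w)) p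
  have h2 := h (hθ.frame (mvfderiv 𝓘(ℝ, Model n) θ p w))
    (hθ.frame (mvfderiv 𝓘(ℝ, Model n) θ p v)) p
  rw [dfield_frame, Conn.along, hθ.frame_mvfderiv] at h1 h2
  rw [h1, h2]
  simp

/-- This is the vanishing of the torsion of `flatConn`, solved for the bracket. -/
lemma mlieBracket_eq (hθ : IsEtale θ) (V W : VField n M) (p : M) :
    VectorField.mlieBracket 𝓘(ℝ, Model n) V W p = hθ.dfield V W p - hθ.dfield W V p := by
  have h := CovariantDerivative.torsion_apply hθ.flatConn
    (V.mdifferentiableAt (x := p)) (W.mdifferentiableAt (x := p))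
  rw [IsParallel.torsion_eq_zero hθ.flatConn_along] at h
  rw [← flatConn_along, ← flatConn_along]
  exact (sub_eq_zero.1 h.symm).symm

/-- Expansion of a tangent vector in the frame of constant vector fields. -/
lemma eq_sum_frame (hθ : IsEtale θ) {p : M} (v : TangentSpace 𝓘(ℝ, Model n) p) :
    v = ∑ i, mvfderiv 𝓘(ℝ, Model n) θ p v i • hθ.frame (EuclideanSpace.single i 1) p := by
  refine hθ.ext_of_mvfderiv ?_
  simp only [map_sum, map_smul, hθ.mvfderiv_frame]
  ext j
  simp [Finset.sum_apply, Pi.single_apply]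

lemma contMDiff_component (hθ : IsEtale θ) (W : VField n M) (i : Fin n) :
    IsSmoothMap n (fun q => mvfderiv 𝓘(ℝ, Model n) θ q (W q) i) :=
  (EuclideanSpace.proj (𝕜 := ℝ) i).contMDiff.comp (contMDiff_mvfderiv_apply hθ.smooth W)

/-- The second derivative `V (W f)`, split into a first order and a tensorial part. -/
lemma mvfderiv_mvfderiv (hθ : IsEtale θ) {f : M → F} (hf : IsSmoothMap n f)
    (V W : VField n M) (p : M) :
    mvfderiv 𝓘(ℝ, Model n) (fun q => mvfderiv 𝓘(ℝ, Model n) f q (W q)) p (V p)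
      = mvfderiv 𝓘(ℝ, Model n) f p (hθ.dfield V W p)
        + ∑ i, mvfderiv 𝓘(ℝ, Model n) θ p (W p) i •
          mvfderiv 𝓘(ℝ, Model n) (fun q => mvfderiv 𝓘(ℝ, Model n) f q
            (hθ.frame (EuclideanSpace.single i 1) q)) p (V p) := by
  have h1 : (fun q => mvfderiv 𝓘(ℝ, Model n) f q (W q)) = fun q =>
      ∑ i, mvfderiv 𝓘(ℝ, Model n) θ q (W q) i •
        mvfderiv 𝓘(ℝ, Model n) f q (hθ.frame (EuclideanSpace.single i 1) q) := by
    ext q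
    conv_lhs => rw [hθ.eq_sum_frame (W q)]
    simp only [map_sum, map_smul]
  have h2 := fun i => contMDiff_mvfderiv_apply hf (hθ.frame (EuclideanSpace.single i 1))
  have h3 : ∀ i, IsSmoothMap n (fun q => mvfderiv 𝓘(ℝ, Model n) θ q (W q) i •
      mvfderiv 𝓘(ℝ, Model n) f q (hθ.frame (EuclideanSpace.single i 1) q)) := fun i =>
    (hθ.contMDiff_component W i).smul (h2 i)
  rw [h1, mvfderiv_finset_sum _ fun i _ => h3 i]
  simp only [mvfderiv_smul_apply (hθ.contMDiff_component W _) (h2 _)]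
  rw [Finset.sum_add_distrib, add_comm]
  congr 1
  conv_rhs => rw [hθ.eq_sum_frame (hθ.dfield V W p)]
  simp only [map_sum, map_smul, hθ.mvfderiv_dfield]
  refine Finset.sum_congr rfl fun i _ => ?_
  congr 1
  exact mvfderiv_clm_apply (EuclideanSpace.proj (𝕜 := ℝ) i)
    ((contMDiff_mvfderiv_apply hθ.smooth W).isDiffAt p) (V p)

end IsEtale

/-- The Lie bracket acts on smooth functions as the commutator. -/
lemma IsCoordSystem.mvfderiv_mlieBracket {θ : OpenPartialHomeomorph M (Model n)}
    (h : IsCoordSystem θ) (hs : θ.source = univ) {f : M → F} (hf : IsSmoothMap n f)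
    (V W : VField n M) (p : M) :
    mvfderiv 𝓘(ℝ, Model n) f p (VectorField.mlieBracket 𝓘(ℝ, Model n) V W p)
      = mvfderiv 𝓘(ℝ, Model n) (fun q => mvfderiv 𝓘(ℝ, Model n) f q (W q)) p (V p)
        - mvfderiv 𝓘(ℝ, Model n) (fun q => mvfderiv 𝓘(ℝ, Model n) f q (V q)) p (W p) := by
  have hθ := h.isEtale hs
  have key : ∀ V W : VField n M, ∑ i, mvfderiv 𝓘(ℝ, Model n) θ p (W p) i •
      mvfderiv 𝓘(ℝ, Model n) (fun q => mvfderiv 𝓘(ℝ, Model n) f q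
        (hθ.frame (EuclideanSpace.single i 1) q)) p (V p)
      = ∑ i, ∑ j, (mvfderiv 𝓘(ℝ, Model n) θ p (W p) i * mvfderiv 𝓘(ℝ, Model n) θ p (V p) j) •
      mvfderiv 𝓘(ℝ, Model n) (fun q => mvfderiv 𝓘(ℝ, Model n) f q
        (hθ.frame (EuclideanSpace.single i 1) q)) p (hθ.frame (EuclideanSpace.single j 1) p) := by
    intro V W
    refine Finset.sum_congr rfl fun i _ => ?_
    conv_lhs => rw [hθ.eq_sum_frame (V p)]
    simp only [map_sum, map_smul, Finset.smul_sum, smul_smul]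
  rw [hθ.mlieBracket_eq, map_sub, hθ.mvfderiv_mvfderiv hf V W, hθ.mvfderiv_mvfderiv hf W V,
    key V W, key W V, Finset.sum_comm]
  have : ∀ i j : Fin n, mvfderiv 𝓘(ℝ, Model n) (fun q => mvfderiv 𝓘(ℝ, Model n) f q
        (hθ.frame (EuclideanSpace.single i 1) q)) p (hθ.frame (EuclideanSpace.single j 1) p)
      = mvfderiv 𝓘(ℝ, Model n) (fun q => mvfderiv 𝓘(ℝ, Model n) f q
        (hθ.frame (EuclideanSpace.single j 1) q)) p (hθ.frame (EuclideanSpace.single i 1) p) :=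
    fun i j => h.mvfderiv_frame_comm hs hf _ _ p
  simp only [fun i j : Fin n => mul_comm (mvfderiv 𝓘(ℝ, Model n) θ p (W p) i)
    (mvfderiv 𝓘(ℝ, Model n) θ p (V p) j)]
  -- The tensorial parts of `V (W f)` and `W (V f)` agree by symmetry of second derivatives. Adding
  -- one of them to both terms on the left allows a termwise comparison.
  conv_lhs => rw [← add_sub_add_right_eq_sub _ _ (∑ i, ∑ j, (mvfderiv 𝓘(ℝ, Model n) θ p (V p) i *
    mvfderiv 𝓘(ℝ, Model n) θ p (W p) j) • mvfderiv 𝓘(ℝ, Model n) (fun q =>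
      mvfderiv 𝓘(ℝ, Model n) f q (hθ.frame (EuclideanSpace.single i 1) q)) p
        (hθ.frame (EuclideanSpace.single j 1) p))]
  congr 2
  refine Finset.sum_congr rfl fun i _ => Finset.sum_congr rfl fun j _ => ?_
  rw [this j i]

end Flat

/-! ### Extension of tangent vectors, and integrals of positive functions -/

section Extend

variable {n : ℕ} {M : Type*} [TopologicalSpace M] [T2Space M] [ChartedSpace (Model n) M]
  [IsManifold 𝓘(ℝ, Model n) ∞ M]

/-- Every tangent vector extends to a smooth vector field. -/
lemma exists_vField_apply_eq {p : M} (v : TangentSpace 𝓘(ℝ, Model n) p) :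
    ∃ V : VField n M, V p = v := by
  obtain ⟨s, hs, hσ⟩ := FiberBundle.exists_contMDiffOn_extend 𝓘(ℝ, Model n) (Model n) (k := ∞) v
  obtain ⟨f, -, hf⟩ := (SmoothBumpFunction.nhds_basis_tsupport (I := 𝓘(ℝ, Model n)) p).mem_iff.1
    (interior_mem_nhds.2 hs)
  -- The bump function equals `1` at `p` and is supported where the local extension of `v` is
  -- smooth.
  refine ⟨⟨fun q => f q • FiberBundle.extend (Model n) v q, ?_⟩, ?_⟩
  · exact ContMDiffOn.smul_section_of_tsupport f.contMDiff.contMDiffOn isOpen_interior hf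
      (hσ.mono interior_subset)
  · change f p • FiberBundle.extend (Model n) v p = v
    rw [f.eq_one, one_smul, FiberBundle.extend_apply_self]

end Extend

section Density

variable {X : Type*} [MeasurableSpace X] {μ : Measure X} {M : Type*} {e : M → X → ℝ}

lemma IsDensitySet.ne_zero (h : IsDensitySet μ e) (p : M) : μ ≠ 0 := by
  rintro rfl
  simpa using h.integral_eq_one p

lemma IsDensitySet.nonempty (h : IsDensitySet μ e) (p : M) : Nonempty X := by
  by_contra hX
  rw [not_nonempty_iff] at hX
  exact h.ne_zero p (Measure.eq_zero_of_isEmpty μ)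

/-- The integral of a positive function is positive. -/
lemma integral_pos_of_pos (hμ : μ ≠ 0) {f : X → ℝ} (hf : Integrable f μ) (hpos : ∀ x, 0 < f x) :
    0 < ∫ x, f x ∂μ := by
  refine (integral_pos_iff_support_of_nonneg (fun x => (hpos x).le) hf).2 ?_
  have : Function.support f = univ := eq_univ_of_forall fun x => (hpos x).ne'
  rw [this]
  exact Measure.measure_univ_pos.2 hμ

end Density

/-! ### Uniqueness of representations up to affine maps, and their globalization -/

section Rep

variable {X : Type*} [TopologicalSpace X] {n : ℕ} {M : Type*} [TopologicalSpace M]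
  [ChartedSpace (Model n) M] {G : Gauge} {e : M → X → ℝ}

namespace ExpCoordRep

variable (R : ExpCoordRep G n e)

lemma isDiffAt_θ {p : M} (hp : p ∈ R.θ.source) : IsDiffAt n R.θ p :=
  (contMDiffAt_of_mem_maximalAtlas R.isCoordSystem hp).mdifferentiableAt (by simp)

lemma isDiffAt_ψ {p : M} (hp : p ∈ R.θ.source) : IsDiffAt n R.ψ p :=
  (R.smooth_ψ.contMDiffAt (R.θ.open_source.mem_nhds hp)).mdifferentiableAt (by simp)

variable {R} in
lemma IsGlobal.isEtale (hR : R.IsGlobal) : IsEtale R.θ := R.isCoordSystem.isEtale hR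

variable {R} in
lemma IsGlobal.mem_source (hR : R.IsGlobal) (p : M) : p ∈ R.θ.source := hR ▸ mem_univ p

variable {R} in
lemma IsGlobal.isSmooth_ψ (hR : R.IsGlobal) : IsSmooth n R.ψ := by
  have := R.smooth_ψ
  rw [hR] at this
  exact contMDiffOn_univ.1 this

lemma lieD_ell (hpos : ∀ p x, 0 < e p x) {p : M} (hp : p ∈ R.θ.source)
    (V : ∀ p : M, TangentSpace 𝓘(ℝ, Model n) p) (x : X) :
    lieD V (fun q => G.ell (e q x)) p
      = inner ℝ (mvfderiv 𝓘(ℝ, Model n) R.θ p (V p)) (R.T x) - lieD V R.ψ p := by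
  have h : (fun q => G.ell (e q x)) =ᶠ[𝓝 p]
      fun q => inner ℝ (R.θ q) (R.T x) - R.c x - R.ψ q := by
    filter_upwards [R.θ.open_source.mem_nhds hp] with q hq using R.ell_eq hpos hq x
  have h1 : IsDiffAt n (fun q => inner ℝ (R.θ q) (R.T x)) p := by
    have := ((innerSL ℝ (R.T x)).differentiableAt (x := R.θ p)).mdifferentiableAt.comp p
      (R.isDiffAt_θ hp)
    refine this.congr_of_eventuallyEq (Eventually.of_forall fun q => ?_)
    simp [real_inner_comm]
  rw [lieD, mvfderiv_congr h]
  change lieD V _ p = _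
  have h2 : IsDiffAt n (fun q => inner ℝ (R.θ q) (R.T x) - R.c x) p :=
    h1.sub mdifferentiableAt_const
  rw [lieD_sub V h2 (R.isDiffAt_ψ hp),
    lieD_sub V h1 mdifferentiableAt_const, lieD_const, sub_zero,
    lieD_inner_const V (R.isDiffAt_θ hp)]

/-- The space spanned by the components of `T` and the constant function `1`. -/
def span : Submodule ℝ (X → ℝ) where
  carrier := {f | ∃ (w : Model n) (k : ℝ), ∀ x, f x = inner ℝ w (R.T x) + k}
  add_mem' := by
    rintro f g ⟨w, k, hf⟩ ⟨w', k', hg⟩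
    exact ⟨w + w', k + k', fun x => by rw [Pi.add_apply, hf, hg, inner_add_left]; ring⟩
  zero_mem' := ⟨0, 0, fun x => by simp⟩
  smul_mem' := by
    rintro r f ⟨w, k, hf⟩
    exact ⟨r • w, r * k, fun x => by
      rw [Pi.smul_apply, hf, real_inner_smul_left, smul_eq_mul, mul_add]⟩



lemma inner_add_mem_span (w : Model n) (k : ℝ) : (fun x => inner ℝ w (R.T x) + k) ∈ R.span :=
  ⟨w, k, fun _ => rfl⟩

lemma const_mem_span (k : ℝ) : (fun _ => k) ∈ R.span := ⟨0, k, fun x => by simp⟩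

/-- The function `c` cancels in the difference. -/
lemma ell_sub_mem_span (hpos : ∀ p x, 0 < e p x) {p q : M} (hp : p ∈ R.θ.source)
    (hq : q ∈ R.θ.source) : (fun x => G.ell (e p x) - G.ell (e q x)) ∈ R.span :=
  ⟨R.θ p - R.θ q, R.ψ q - R.ψ p, fun x => by
    simp only [R.ell_eq hpos hp, R.ell_eq hpos hq, inner_sub_left]
    ring⟩

/-- Moving `p` by `t • a` in the coordinates of `R` changes `ℓ ∘ e` by `t ⟨a, T⟩` plus a constant.
For small `t ≠ 0` the new point is still in the domain of `R'`, so this change lies in `R'.span`,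
and one divides by `t`. -/
lemma span_le_span (hpos : ∀ p x, 0 < e p x) {R R' : ExpCoordRep G n e} {p : M}
    (hp : p ∈ R.θ.source) (hp' : p ∈ R'.θ.source) : R.span ≤ R'.span := by
  have key : ∀ a : Model n, (fun x => inner ℝ a (R.T x)) ∈ R'.span := by
    intro a
    have h1 : ∀ᶠ t : ℝ in 𝓝 0, R.θ p + t • a ∈ R.θ.target ∩ R.θ.symm ⁻¹' R'.θ.source := by
      have hc : Tendsto (fun t : ℝ => R.θ p + t • a) (𝓝 0) (𝓝 (R.θ p)) := by
        have : Continuous fun t : ℝ => R.θ p + t • a := by fun_prop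
        simpa using this.tendsto 0
      refine hc ((R.θ.isOpen_inter_preimage_symm R'.θ.open_source).mem_nhds
        ⟨R.θ.map_source hp, ?_⟩)
      rwa [mem_preimage, R.θ.left_inv hp]
    obtain ⟨t, ⟨ht, ht'⟩, ht0⟩ := ((h1.filter_mono nhdsWithin_le_nhds).and
      (self_mem_nhdsWithin : {(0 : ℝ)}ᶜ ∈ 𝓝[≠] (0 : ℝ))).exists
    set q := R.θ.symm (R.θ p + t • a) with hq
    have hqs : q ∈ R.θ.source := R.θ.map_target ht
    have hθq : R.θ q = R.θ p + t • a := R.θ.right_inv ht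
    have h2 := R'.ell_sub_mem_span hpos ht' hp'
    have h3 : (fun x => inner ℝ a (R.T x)) = t⁻¹ • ((fun x => G.ell (e q x) - G.ell (e p x))
        + fun _ => (R.ψ q - R.ψ p)) := by
      ext x
      have ht0' : t ≠ 0 := ht0
      simp only [Pi.smul_apply, Pi.add_apply, R.ell_eq hpos hqs, R.ell_eq hpos hp, hθq,
        inner_add_left, real_inner_smul_left, smul_eq_mul]
      field_simp
      ring
    rw [h3]
    exact R'.span.smul_mem _ (R'.span.add_mem h2 (R'.const_mem_span _))
  rintro f ⟨w, k, hf⟩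
  have : f = (fun x => inner ℝ w (R.T x)) + fun _ => k := funext hf
  rw [this]
  exact R'.span.add_mem (key w) (R'.const_mem_span k)

lemma span_eq_span (hpos : ∀ p x, 0 < e p x) {R R' : ExpCoordRep G n e} {p : M}
    (hp : p ∈ R.θ.source) (hp' : p ∈ R'.θ.source) : R.span = R'.span :=
  le_antisymm (span_le_span hpos hp hp') (span_le_span hpos hp' hp)

/-- On a connected manifold, the spaces spanned by different representations agree. -/
lemma exists_span_eq [ConnectedSpace M] (hpos : ∀ p x, 0 < e p x)
    (hex : ∀ p : M, ∃ R : ExpCoordRep G n e, p ∈ R.θ.source) {p : M} (hp : p ∈ R.θ.source)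
    (q : M) : ∃ R' : ExpCoordRep G n e, q ∈ R'.θ.source ∧ R'.span = R.span ∧
      (fun x => G.ell (e q x) - G.ell (e p x)) ∈ R.span := by
  let A : Set M := {q | ∃ R' : ExpCoordRep G n e, q ∈ R'.θ.source ∧ R'.span = R.span ∧
      (fun x => G.ell (e q x) - G.ell (e p x)) ∈ R.span}
  -- The domain of a representation lies either inside `A` or outside it. As these domains form an
  -- open cover, `A` is clopen.
  have hA : ∀ (R' : ExpCoordRep G n e) (r s : M), r ∈ R'.θ.source → s ∈ R'.θ.source → r ∈ A →
      s ∈ A := by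
    rintro R' r s hr hs ⟨R'', hr'', h1, h2⟩
    have h3 : R'.span = R.span := (span_eq_span hpos hr hr'').trans h1
    refine ⟨R', hs, h3, ?_⟩
    have h4 := R.span.add_mem (h3 ▸ R'.ell_sub_mem_span hpos hs hr) h2
    convert h4 using 1
    ext x
    simp
  have hclopen : IsClopen A := by
    constructor
    · rw [← isOpen_compl_iff, isOpen_iff_mem_nhds]
      intro s hs
      obtain ⟨R', hR'⟩ := hex s
      filter_upwards [R'.θ.open_source.mem_nhds hR'] with r hr hrA
      exact hs (hA R' r s hr hR' hrA)
    · rw [isOpen_iff_mem_nhds]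
      intro s hs
      obtain ⟨R', hR'⟩ := hex s
      filter_upwards [R'.θ.open_source.mem_nhds hR'] with r hr
      exact hA R' s r hR' hr hs
  have hpA : p ∈ A := ⟨R, hp, rfl, by simpa using R.const_mem_span 0⟩
  exact (hclopen.eq_univ ⟨p, hpA⟩).ge (mem_univ q)

variable [MeasurableSpace X] {μ : Measure X} [T2Space M] [IsManifold 𝓘(ℝ, Model n) ∞ M]

/-- The components of `T` and the constant function `1` are linearly independent. -/
lemma eq_zero_of_inner_ae_eq [μ.IsOpenPosMeasure] (h : IsStatisticalModel n μ e)
    (hχ : IIExists μ e G.chi) {p : M} (hp : p ∈ R.θ.source) {a : Model n} {b : ℝ}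
    (hab : ∀ᵐ x ∂μ, inner ℝ a (R.T x) = b) : a = 0 := by
  -- Both sides are continuous and `μ` charges every nonempty open set.
  have hab' : ∀ x, inner ℝ a (R.T x) = b := by
    have h1 : Continuous fun x => inner ℝ a (R.T x) := continuous_const.inner R.continuous_T
    have := Measure.eq_of_ae_eq (μ := μ) (g := fun _ => b) hab h1 continuous_const
    exact fun x => congrFun this x
  have hpos := h.isDensitySet.pos
  have hI := R.mem_I hpos hp
  obtain ⟨N, hN, -, hsm, -, hinj⟩ := h.exists_null
  -- Along the direction `a` the derivative of `ℓ ∘ e_x` is `b - Vψ`, the same for all `x`. So `V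
  -- e_x` is this number times `χ(e_x) > 0`; since `V e_x` has integral zero, the number vanishes,
  -- hence so does `V` at `p`.
  obtain ⟨V, hV⟩ := exists_vField_apply_eq ((mvfderiv 𝓘(ℝ, Model n) R.θ p).inverse a)
  have hVa : mvfderiv 𝓘(ℝ, Model n) R.θ p (V p) = a := by
    rw [hV]
    exact (R.isCoordSystem.isInvertible hp).self_apply_inverse a
  have hd : ∀ x ∉ N, lieD V (fun q => e q x) p = G.chi (e p x) * (b - lieD V R.ψ p) := by
    intro x hx
    have h1 := R.lieD_ell hpos hp V x
    rw [hVa, hab', lieD_comp V (G.differentiableAt_ell (hI x)) ((hsm x hx).isDiffAt p)] at h1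
    rw [← h1, Gauge.chi, one_div, inv_mul_cancel_left₀ (G.deriv_ell_pos (hI x)).ne']
  have hN' : ∀ᵐ x ∂μ, x ∉ N := measure_eq_zero_iff_ae_notMem.1 hN
  have hint : (∫ x, G.chi (e p x) ∂μ) * (b - lieD V R.ψ p) = 0 := by
    rw [← integral_mul_const, ← (h.integral_lieD V p).2]
    refine integral_congr_ae ?_
    filter_upwards [hN'] with x hx using (hd x hx).symm
  have hχpos : 0 < ∫ x, G.chi (e p x) ∂μ :=
    integral_pos_of_pos (h.isDensitySet.ne_zero p) (hχ p) fun x => G.chi_pos (hI x)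
  have hb : b - lieD V R.ψ p = 0 := (mul_eq_zero.1 hint).resolve_left hχpos.ne'
  have hV0 : V p = 0 := (hinj V p).1 fun x hx => by rw [hd x hx, hb, mul_zero]
  rw [← hVa, hV0, map_zero]

/-- If the components of `T` and `1` span the same space for two representations, then they are
related by an affine equivalence. -/
lemma exists_equiv_of_span_eq [μ.IsOpenPosMeasure] (h : IsStatisticalModel n μ e)
    (hχ : IIExists μ e G.chi) {R R' : ExpCoordRep G n e} {p p' : M} (hp : p ∈ R.θ.source)
    (hp' : p' ∈ R'.θ.source) (hspan : R.span = R'.span) :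
    ∃ (B : Model n ≃L[ℝ] Model n) (β : Model n → ℝ),
      ∀ a x, inner ℝ a (R.T x) = inner ℝ (B a) (R'.T x) + β a := by
  have h1 : ∀ a, ∃ (b : Model n) (β : ℝ), ∀ x, inner ℝ a (R.T x) = inner ℝ b (R'.T x) + β := by
    intro a
    have : (fun x => inner ℝ a (R.T x) + 0) ∈ R'.span := hspan ▸ R.inner_add_mem_span a 0
    obtain ⟨b, β, hb⟩ := this
    exact ⟨b, β, fun x => by simpa using hb x⟩
  choose b β hb using h1
  have hind : ∀ (a : Model n) (c : ℝ), (∀ x, inner ℝ a (R'.T x) = c) → a = 0 := fun a c hc =>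
    R'.eq_zero_of_inner_ae_eq h hχ hp' (Eventually.of_forall hc)
  -- By independence the coefficient vector `b a` is unique, which forces linearity.
  let L : Model n →ₗ[ℝ] Model n :=
    { toFun := b
      map_add' := fun a a' => by
        refine sub_eq_zero.1 (hind _ (β a + β a' - β (a + a')) fun x => ?_)
        have h1 := hb (a + a') x
        rw [inner_add_left, hb a, hb a'] at h1
        rw [inner_sub_left, inner_add_left]
        linarith
      map_smul' := fun r a => by
        refine sub_eq_zero.1 (hind _ (r * β a - β (r • a)) fun x => ?_)
        have h1 := hb (r • a) x
        rw [real_inner_smul_left, hb a] at h1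
        rw [inner_sub_left, RingHom.id_apply, real_inner_smul_left]
        linarith }
  have hL : Function.Injective L := by
    rw [← LinearMap.ker_eq_bot, LinearMap.ker_eq_bot']
    intro a ha
    refine R.eq_zero_of_inner_ae_eq h hχ hp (b := β a) (Eventually.of_forall fun x => ?_)
    have ha' : b a = 0 := ha
    rw [hb a, ha', inner_zero_left, zero_add]
  exact ⟨(LinearEquiv.ofInjectiveEndo L hL).toContinuousLinearEquiv, β, fun a x => hb a x⟩

end ExpCoordRep

lemma IsExpFamily.mem_I' {X : Type*} [TopologicalSpace X] [MeasurableSpace X] {μ : Measure X}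
    {n : ℕ} {M : Type*} [TopologicalSpace M] [ChartedSpace (Model n) M]
    [IsManifold 𝓘(ℝ, Model n) ∞ M] {G : Gauge} {e : M → X → ℝ}
    (h : IsExpFamily G n μ e) (p : M) (x : X) : e p x ∈ G.I := by
  obtain ⟨R, hR⟩ := h.exists_rep p
  exact R.mem_I h.isStatisticalModel.isDensitySet.pos hR x

/-- Elements whose densities differ by a constant on the `ℓ`-scale agree. -/
lemma IsExpFamily.eq_of_ell_sub_eq {X : Type*} [TopologicalSpace X] [MeasurableSpace X]
    {μ : Measure X} {n : ℕ} {M : Type*} [TopologicalSpace M] [ChartedSpace (Model n) M]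
    [IsManifold 𝓘(ℝ, Model n) ∞ M] {G : Gauge} {e : M → X → ℝ}
    (h : IsExpFamily G n μ e) {p q : M} {k : ℝ}
    (hk : ∀ x, G.ell (e p x) - G.ell (e q x) = k) : p = q := by
  have hd := h.isStatisticalModel.isDensitySet
  -- A positive `k` would make `p` larger than `q` at every `x`, although both densities have
  -- integral `1`.
  have key : ∀ (p q : M) (k : ℝ), (∀ x, G.ell (e p x) - G.ell (e q x) = k) → ¬ 0 < k := by
    intro p q k hk hk0
    have h1 : ∀ x, 0 < e p x - e q x := fun x => by
      have : G.ell (e q x) < G.ell (e p x) := by linarith [hk x]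
      exact sub_pos.2 ((G.strictMonoOn_ell.lt_iff_lt (h.mem_I' q x) (h.mem_I' p x)).1 this)
    have h2 := integral_pos_of_pos (hd.ne_zero p) ((hd.integrable p).sub (hd.integrable q)) h1
    simp only [Pi.sub_apply] at h2
    rw [integral_sub (hd.integrable p) (hd.integrable q), hd.integral_eq_one,
      hd.integral_eq_one] at h2
    simp at h2
  have hk0 : k = 0 := le_antisymm (not_lt.1 (key p q k hk))
    (neg_nonpos.1 (not_lt.1 (key q p (-k) fun x => by rw [← hk x]; ring)))
  refine hd.injective p q (Eventually.of_forall fun x => ?_)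
  exact G.strictMonoOn_ell.injOn (h.mem_I' p x) (h.mem_I' q x) (by linarith [hk x])

/-- On a connected exponential family, global representations exist. -/
theorem IsExpFamily.exists_isGlobal {X : Type*} [TopologicalSpace X] [MeasurableSpace X]
    {μ : Measure X} [μ.IsOpenPosMeasure] {n : ℕ} {M : Type*} [TopologicalSpace M] [T2Space M]
    [ConnectedSpace M] [ChartedSpace (Model n) M]
    [IsManifold 𝓘(ℝ, Model n) ∞ M] {G : Gauge} {e : M → X → ℝ}
    (h : IsExpFamily G n μ e) (hχ : IIExists μ e G.chi) :
    ∃ R : ExpCoordRep G n e, R.IsGlobal := by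
  have hs := h.isStatisticalModel
  have hpos := hs.isDensitySet.pos
  obtain ⟨p₀⟩ : Nonempty M := inferInstance
  obtain ⟨x₀⟩ := hs.isDensitySet.nonempty p₀
  obtain ⟨R₀, hp₀⟩ := h.exists_rep p₀
  have h1 := fun q => R₀.exists_span_eq hpos h.exists_rep hp₀ q
  choose R hR hspan hmem using h1
  have hmem' : ∀ q, ∃ (w : Model n) (k : ℝ), ∀ x,
      G.ell (e q x) - G.ell (e p₀ x) = inner ℝ w (R₀.T x) + k := hmem
  -- The global coordinates are the coefficients of `ℓ(e_q) - ℓ(e_{p₀})` with respect to `R₀.T`; the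
  -- constant term `k` becomes minus the normalization.
  choose θ k hθ using hmem'
  -- Expanding `ℓ(e_s) - ℓ(e_q)` in both `(R q).T` and `R₀.T` and comparing coefficients shows that
  -- `θ` is an affine isomorphism of the chart `(R q).θ`. Smoothness and openness of `θ` follow from
  -- this.
  have hloc : ∀ q, ∃ B : Model n ≃L[ℝ] Model n, ∀ s ∈ (R q).θ.source,
      θ s = B ((R q).θ s - (R q).θ q) + θ q := by
    intro q
    obtain ⟨B, β, hB⟩ := ExpCoordRep.exists_equiv_of_span_eq hs hχ (hR q) hp₀ (hspan q)
    refine ⟨B, fun s hsq => ?_⟩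
    refine sub_eq_zero.1 (R₀.eq_zero_of_inner_ae_eq (μ := μ) hs hχ hp₀
      (b := β ((R q).θ s - (R q).θ q) + k q - k s - (R q).ψ s + (R q).ψ q)
      (Eventually.of_forall fun x => ?_))
    have e1 := hθ s x
    have e2 := hθ q x
    have e3 := (R q).ell_eq hpos hsq x
    have e4 := (R q).ell_eq hpos (hR q) x
    have e5 := hB ((R q).θ s - (R q).θ q) x
    rw [inner_sub_left] at e5
    rw [inner_sub_left, inner_add_left]
    linarith
  choose B hB using hloc
  have hsm : IsSmoothMap n θ := fun q => by
    have h2 : ContMDiffAt 𝓘(ℝ, Model n) 𝓘(ℝ, Model n) ∞ (R q).θ q :=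
      contMDiffAt_of_mem_maximalAtlas (R q).isCoordSystem (hR q)
    have h3 : ContDiff ℝ ∞ fun y : Model n => B q (y - (R q).θ q) + θ q := by fun_prop
    refine (h3.contMDiff.contMDiffAt.comp q h2).congr_of_eventuallyEq ?_
    filter_upwards [(R q).θ.open_source.mem_nhds (hR q)] with s hs using hB q s hs
  have hinj : Function.Injective θ := by
    intro p q hpq
    refine h.eq_of_ell_sub_eq (k := k p - k q) fun x => ?_
    have e1 := hθ p x
    have e2 := hθ q x
    rw [hpq] at e1
    linarith
  have hinv : ∀ q, ∀ᶠ y in 𝓝 (θ q), (B q).symm (y - θ q) + (R q).θ q ∈ (R q).θ.target ∧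
      θ ((R q).θ.symm ((B q).symm (y - θ q) + (R q).θ q)) = y := by
    intro q
    have hc : Tendsto (fun y => (B q).symm (y - θ q) + (R q).θ q) (𝓝 (θ q)) (𝓝 ((R q).θ q)) := by
      have : Continuous fun y => (B q).symm (y - θ q) + (R q).θ q := by fun_prop
      simpa using this.tendsto (θ q)
    filter_upwards [hc ((R q).θ.open_target.mem_nhds ((R q).θ.map_source (hR q)))] with y hy
    refine ⟨hy, ?_⟩
    rw [hB q _ ((R q).θ.map_target hy), (R q).θ.right_inv hy]
    simp
  have hopen : IsOpenMap θ := by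
    refine IsOpenMap.of_nhds_le fun q s hs => ?_
    have hc : ContinuousAt (fun y => (R q).θ.symm ((B q).symm (y - θ q) + (R q).θ q)) (θ q) := by
      refine ContinuousAt.comp (g := (R q).θ.symm) ?_ (by fun_prop)
      simpa using (R q).θ.continuousAt_symm ((R q).θ.map_source (hR q))
    have h4 : (R q).θ.symm ((B q).symm (θ q - θ q) + (R q).θ q) = q := by
      simp [(R q).θ.left_inv (hR q)]
    have h5 := hc (by simp only [h4]; exact hs : θ ⁻¹' s ∈ _)
    filter_upwards [h5, hinv q] with y hy hy'
    rw [← hy'.2]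
    exact hy
  have hemb : IsOpenEmbedding θ := IsOpenEmbedding.of_continuous_injective_isOpenMap
    hsm.continuous hinj hopen
  let Θ : OpenPartialHomeomorph M (Model n) := hemb.toOpenPartialHomeomorph θ
  have hΘsymm : ∀ y q, θ q = y → Θ.symm y = q := fun y q hq => by
    rw [← hq]
    exact Θ.left_inv (mem_univ q)
  refine ⟨{
    θ := Θ
    T := R₀.T
    c := fun x => - G.ell (e p₀ x)
    ψ := fun q => - k q
    isCoordSystem := ?_
    continuous_T := R₀.continuous_T
    continuous_c := ?_
    smooth_ψ := ?_
    repr := ?_ }, rfl⟩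
  · refine Θ.mem_maximalAtlas_of_contMDiffOn hsm.contMDiffOn ?_
    rintro _ hy
    obtain ⟨q, -, rfl⟩ : _ ∈ θ '' univ := by simpa [Θ] using hy
    refine ContMDiffAt.contMDiffWithinAt ?_
    have h6 : ContDiff ℝ ∞ fun y : Model n => (B q).symm (y - θ q) + (R q).θ q := by fun_prop
    have h7 : ContMDiffAt 𝓘(ℝ, Model n) 𝓘(ℝ, Model n) ∞ (R q).θ.symm
        ((fun y : Model n => (B q).symm (y - θ q) + (R q).θ q) (θ q)) := by
      refine contMDiffAt_symm_of_mem_maximalAtlas (R q).isCoordSystem ?_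
      simpa using (R q).θ.map_source (hR q)
    refine (h7.comp (θ q) h6.contMDiff.contMDiffAt).congr_of_eventuallyEq ?_
    filter_upwards [hinv q] with y hy using hΘsymm _ _ hy.2
  · have : (fun x => - G.ell (e p₀ x))
        = fun x => - (inner ℝ (R₀.θ p₀) (R₀.T x) - R₀.c x - R₀.ψ p₀) :=
      funext fun x => by rw [R₀.ell_eq hpos hp₀]
    rw [this]
    exact (((continuous_const.inner R₀.continuous_T).sub R₀.continuous_c).sub
      continuous_const).neg
  · intro q _
    refine ContMDiffAt.contMDiffWithinAt ?_
    -- The function `k` was chosen pointwise. Evaluating its defining relation at the single point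
    -- `x₀` expresses it through smooth functions.
    have hk : (fun s => - k s) =ᶠ[𝓝 q] fun s => inner ℝ (θ s) (R₀.T x₀) + G.ell (e p₀ x₀)
        - (inner ℝ ((R q).θ s) ((R q).T x₀) - (R q).c x₀ - (R q).ψ s) := by
      filter_upwards [(R q).θ.open_source.mem_nhds (hR q)] with s hsq
      rw [← (R q).ell_eq hpos hsq]
      linarith [hθ s x₀]
    have hi : ∀ v : Model n, ContDiff ℝ ∞ fun y : Model n => inner ℝ y v :=
      fun v => contDiff_id.inner ℝ contDiff_const
    have h2 : ContMDiffAt 𝓘(ℝ, Model n) 𝓘(ℝ, Model n) ∞ (R q).θ q :=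
      contMDiffAt_of_mem_maximalAtlas (R q).isCoordSystem (hR q)
    exact ((((hi _).contMDiff.contMDiffAt.comp q (hsm q)).add contMDiffAt_const).sub
      ((((hi _).contMDiff.contMDiffAt.comp q h2).sub contMDiffAt_const).sub
      ((R q).smooth_ψ.contMDiffAt ((R q).θ.open_source.mem_nhds (hR q))))).congr_of_eventuallyEq hk
  · intro q _ x
    have : inner ℝ (θ q) (R₀.T x) - - G.ell (e p₀ x) - - k q = G.ell (e q x) := by
      linarith [hθ q x]
    change _ = G.expFn (inner ℝ (θ q) (R₀.T x) - - G.ell (e p₀ x) - - k q)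
    rw [this, G.expFn_ell (h.mem_I' q x)]

end Rep

/-! ### Derivatives of the divergence integrand on the diagonal -/

section Pointwise

variable {X : Type*} {n : ℕ} {M : Type*} [TopologicalSpace M] [ChartedSpace (Model n) M]
  {G : Gauge} {e : M → X → ℝ}

/-- The weight `ρ = τ' / ℓ'` of the metric on the `ℓ`-scale. -/
def Gauge.rho (G : Gauge) (t : ℝ) : ℝ := deriv G.τ t / deriv G.ell t

lemma Gauge.rho_pos (G : Gauge) {t : ℝ} (ht : t ∈ G.I) : 0 < G.rho t :=
  div_pos (G.deriv_τ_pos t ht) (G.deriv_ell_pos ht)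

variable {x : X}

lemma lieD_tau (he : IsSmooth n fun q => e q x) (hI : ∀ q, e q x ∈ G.I)
    (V : ∀ p : M, TangentSpace 𝓘(ℝ, Model n) p) (p : M) :
    lieD V (fun q => G.τ (e q x)) p = G.rho (e p x) * lieD V (fun q => G.ell (e q x)) p := by
  rw [lieD_comp V (G.differentiableAt_τ (hI p)) (he.isDiffAt p),
    lieD_comp V (G.differentiableAt_ell (hI p)) (he.isDiffAt p), Gauge.rho, ← mul_assoc,
    div_mul_cancel₀ _ (G.deriv_ell_pos (hI p)).ne']

lemma lieD_sStar (he : IsSmooth n fun q => e q x) (hI : ∀ q, e q x ∈ G.I)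
    (V : ∀ p : M, TangentSpace 𝓘(ℝ, Model n) p) (p : M) :
    lieD V (fun q => G.sStar (e q x)) p
      = - G.τ (e p x) * lieD V (fun q => G.ell (e q x)) p := by
  have hs : DifferentiableAt ℝ G.sStar (e p x) :=
    (G.contDiffOn_sStar.contDiffAt (G.isOpen_I.mem_nhds (hI p))).differentiableAt (by simp)
  rw [lieD_comp V hs (he.isDiffAt p), G.deriv_sStar (hI p),
    lieD_comp V (G.differentiableAt_ell (hI p)) (he.isDiffAt p), mul_assoc]

/-- With the variables separated as in `Gauge.d_eq`, only `-τ(t) ℓ(s)` survives a derivative in each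
slot, and `dτ = ρ dℓ`. -/
lemma lieFst_lieSnd_dEval (he : IsSmooth n fun q => e q x) (hI : ∀ q, e q x ∈ G.I)
    (V W : ∀ p : M, TangentSpace 𝓘(ℝ, Model n) p) (p : M) :
    lieFst V (lieSnd W (dEval G e x)) p p
      = - (G.rho (e p x) * (lieD V (fun q => G.ell (e q x)) p *
        lieD W (fun q => G.ell (e q x)) p)) := by
  have hτ := (he.comp_of_contDiffOn G.isOpen_I G.smooth_τ hI).isDiffAt
  have hu := (he.comp_of_contDiffOn G.isOpen_I G.contDiffOn_ell hI).isDiffAt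
  have hs := (he.comp_of_contDiffOn G.isOpen_I G.contDiffOn_sStar hI).isDiffAt
  have h1 : ∀ q, lieSnd W (dEval G e x) q p =
      G.τ (e p x) * lieD W (fun q => G.ell (e q x)) p
        - lieD W (fun q => G.ell (e q x)) p * G.τ (e q x) := by
    intro q
    simp only [lieSnd, dEval, G.d_eq]
    have h2 : IsDiffAt n (fun r => G.h (G.τ (e q x)) - G.sStar (e r x)) p :=
      mdifferentiableAt_const.sub (hs p)
    have h3 : IsDiffAt n (fun r => G.τ (e q x) * G.ell (e r x)) p :=
      mdifferentiableAt_const.mul (hu p)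
    rw [lieD_sub W h2 h3, lieD_sub W mdifferentiableAt_const (hs p), lieD_const,
      lieD_const_mul W _ (hu p), lieD_sStar he hI]
    ring
  simp only [lieFst, h1]
  have h4 : IsDiffAt n (fun q => lieD W (fun q => G.ell (e q x)) p * G.τ (e q x)) p :=
    mdifferentiableAt_const.mul (hτ p)
  rw [lieD_sub V mdifferentiableAt_const h4, lieD_const, lieD_const_mul V _ (hτ p),
    lieD_tau he hI]
  ring

/-- Again only `-τ(t) ℓ(s)` contributes. Both derivatives in the second slot fall on `ℓ`, so the
factor from `τ` is constant for them. -/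
lemma lieSnd_lieSnd_lieFst_dEval (he : IsSmooth n fun q => e q x) (hI : ∀ q, e q x ∈ G.I)
    (Z : ∀ p : M, TangentSpace 𝓘(ℝ, Model n) p) (p : M)
    (W : ∀ p : M, TangentSpace 𝓘(ℝ, Model n) p) [IsManifold 𝓘(ℝ, Model n) ∞ M] (V : VField n M) :
    lieSnd Z (lieSnd V (lieFst W (dEval G e x))) p p
      = - (G.rho (e p x) * lieD W (fun q => G.ell (e q x)) p *
        lieD Z (lieD V (fun q => G.ell (e q x))) p) := by
  have hτ := (he.comp_of_contDiffOn G.isOpen_I G.smooth_τ hI).isDiffAt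
  have hh := (he.comp_of_contDiffOn G.isOpen_I G.contDiffOn_h_comp hI).isDiffAt
  have hu' := he.comp_of_contDiffOn G.isOpen_I G.contDiffOn_ell hI
  have hu := hu'.isDiffAt
  have h1 : ∀ q r, lieFst W (dEval G e x) q r =
      lieD W (fun q => G.h (G.τ (e q x))) q
        - lieD W (fun q => G.τ (e q x)) q * G.ell (e r x) := by
    intro q r
    simp only [lieFst, dEval, G.d_eq]
    have h2 : IsDiffAt n (fun q => G.h (G.τ (e q x)) - G.sStar (e r x)) q :=
      (hh q).sub mdifferentiableAt_const
    have h3 : IsDiffAt n (fun q => G.τ (e q x) * G.ell (e r x)) q :=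
      (hτ q).mul mdifferentiableAt_const
    rw [lieD_sub W h2 h3, lieD_sub W (hh q) mdifferentiableAt_const, lieD_const,
      lieD_mul W (hτ q) mdifferentiableAt_const, lieD_const]
    ring
  have h5 : ∀ q r, lieSnd V (lieFst W (dEval G e x)) q r =
      (- lieD W (fun q => G.τ (e q x)) q) * lieD V (fun q => G.ell (e q x)) r := by
    intro q r
    simp only [lieSnd, h1]
    have h3 : IsDiffAt n (fun r => lieD W (fun q => G.τ (e q x)) q * G.ell (e r x)) r :=
      mdifferentiableAt_const.mul (hu r)
    rw [lieD_sub V mdifferentiableAt_const h3, lieD_const, lieD_const_mul V _ (hu r)]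
    ring
  have h6 : lieSnd Z (lieSnd V (lieFst W (dEval G e x))) p p
      = lieD Z (fun r => (- lieD W (fun q => G.τ (e q x)) p) *
        lieD V (fun q => G.ell (e q x)) r) p := by
    change lieD Z (fun r => lieSnd V (lieFst W (dEval G e x)) p r) p = _
    simp only [h5]
  rw [h6, lieD_const_mul Z _ ((hu'.lieD V).isDiffAt p), lieD_tau he hI]
  change -(G.rho (e p x) * _) * lieD Z (lieD V (fun q => G.ell (e q x))) p = _
  ring

end Pointwise

/-! ### Modification of the flat connection by the Hessian of the normalization -/

section NormConnection

variable {n : ℕ} {M : Type*} [TopologicalSpace M] [ChartedSpace (Model n) M]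

instance (p : M) : FiniteDimensional ℝ (TangentSpace 𝓘(ℝ, Model n) p) :=
  inferInstanceAs (FiniteDimensional ℝ (Model n))

instance (p : M) : T2Space (TangentSpace 𝓘(ℝ, Model n) p) :=
  inferInstanceAs (T2Space (Model n))

/-- Maps to the model space are smooth if their components are. -/
lemma isSmoothMap_of_components {f : M → Model n} (h : ∀ i, IsSmooth n fun q => f q i) :
    IsSmoothMap n f := by
  have h1 : IsSmoothMap n fun q => ∑ i, f q i • (EuclideanSpace.single i 1 : Model n) :=
    contMDiff_finsetSum fun i _ => (h i).smul contMDiff_const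
  convert h1 using 1
  ext q j
  simp [Finset.sum_apply, Pi.single_apply]

variable {X : Type*} [TopologicalSpace X] [IsManifold 𝓘(ℝ, Model n) ∞ M]
  {G : Gauge} {e : M → X → ℝ} {R : ExpCoordRep G n e}

namespace ExpCoordRep

/-- The second covariant derivative of the normalization, with respect to the flat connection of
the coordinates. -/
def hessNorm (hR : R.IsGlobal) (Z V : VField n M) (p : M) : ℝ :=
  lieD Z (lieD V R.ψ) p - lieD (hR.isEtale.dfield Z V) R.ψ p

/-- Up to the term `-ψ`, the function `ℓ ∘ e_x` is affine in `θ`. Its Hessian for the flat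
connection is therefore `-Hess ψ`, which does not depend on `x`. -/
lemma lieD_lieD_ell (hR : R.IsGlobal) (hpos : ∀ p x, 0 < e p x) (Z V : VField n M) (p : M)
    (x : X) : lieD Z (lieD V fun q => G.ell (e q x)) p
      = lieD (hR.isEtale.dfield Z V) (fun q => G.ell (e q x)) p - hessNorm hR Z V p := by
  have h1 : lieD V (fun q => G.ell (e q x))
      = fun q => inner ℝ (mvfderiv 𝓘(ℝ, Model n) R.θ q (V q)) (R.T x) - lieD V R.ψ q :=
    funext fun q => R.lieD_ell hpos (hR.mem_source q) V x
  have h2 := contMDiff_mvfderiv_apply hR.isEtale.smooth V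
  have h3 : IsDiffAt n (fun q => inner ℝ (mvfderiv 𝓘(ℝ, Model n) R.θ q (V q)) (R.T x)) p := by
    have := ((innerSL ℝ (R.T x)).differentiableAt).mdifferentiableAt.comp p (h2.isDiffAt p)
    refine this.congr_of_eventuallyEq (Eventually.of_forall fun q => ?_)
    simp [real_inner_comm]
  rw [h1, lieD_sub _ h3 ((hR.isSmooth_ψ.lieD V).isDiffAt p), lieD_inner_const _ (h2.isDiffAt p),
    R.lieD_ell hpos (hR.mem_source p), hR.isEtale.mvfderiv_dfield, hessNorm]
  change _ - lieD Z (lieD V R.ψ) p = _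
  ring

/-- The difference between the connection and the flat connection of the coordinates. -/
def connForm (hR : R.IsGlobal) (γ : VField n M) (p : M) :
    TangentSpace 𝓘(ℝ, Model n) p →L[ℝ]
      TangentSpace 𝓘(ℝ, Model n) p →L[ℝ] TangentSpace 𝓘(ℝ, Model n) p :=
  LinearMap.toContinuousLinearMap
    -- The first argument is the value of the differentiated field, the second one the direction of
    -- differentiation.
    { toFun := fun w => - ∑ i, mvfderiv 𝓘(ℝ, Model n) R.θ p w i •
        (mvfderiv 𝓘(ℝ, Model n)
          (lieD (hR.isEtale.frame (EuclideanSpace.single i 1)) R.ψ) p).smulRight (γ p)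
      map_add' := fun v w => by
        simp only [map_add, PiLp.add_apply, add_smul, Finset.sum_add_distrib, neg_add]
      map_smul' := fun r w => by
        simp only [map_smul, PiLp.smul_apply, smul_eq_mul, mul_smul, RingHom.id_apply, smul_neg,
          Finset.smul_sum] }

/-- Shows that the Hessian depends on `V` only through `V p`, which is what lets `connForm` act on
tangent vectors. -/
lemma hessNorm_eq_sum (hR : R.IsGlobal) (Z V : VField n M) (p : M) :
    hessNorm hR Z V p = ∑ i, mvfderiv 𝓘(ℝ, Model n) R.θ p (V p) i *
      lieD Z (lieD (hR.isEtale.frame (EuclideanSpace.single i 1)) R.ψ) p := by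
  have := hR.isEtale.mvfderiv_mvfderiv hR.isSmooth_ψ Z V p
  rw [hessNorm, sub_eq_iff_eq_add']
  exact this

lemma connForm_apply (hR : R.IsGlobal) (γ Z V : VField n M) (p : M) :
    connForm hR γ p (V p) (Z p) = - (hessNorm hR Z V p • γ p) := by
  rw [hessNorm_eq_sum, Finset.sum_smul]
  simp only [connForm, LinearMap.coe_toContinuousLinearMap', LinearMap.coe_mk, AddHom.coe_mk,
    neg_apply, sum_apply, smul_apply, ContinuousLinearMap.smulRight_apply,
    smul_smul]
  rfl

/-- The connection whose difference from the flat one is `-Hess(ψ) ⊗ γ`. -/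
def conn (hR : R.IsGlobal) (γ : VField n M) : Conn n M :=
  CovariantDerivative.addOneForm hR.isEtale.flatConn (connForm hR γ)

lemma isSmooth_hessNorm (hR : R.IsGlobal) (Z V : VField n M) : IsSmooth n (hessNorm hR Z V) :=
  ((hR.isSmooth_ψ.lieD V).lieD Z).sub (hR.isSmooth_ψ.lieD _)

lemma conn_along (hR : R.IsGlobal) (γ Z V : VField n M) (p : M) :
    Conn.along (conn hR γ) Z V p = hR.isEtale.dfield Z V p - hessNorm hR Z V p • γ p := by
  rw [← hR.isEtale.flatConn_along, sub_eq_add_neg, ← connForm_apply]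
  rfl

lemma smooth_conn (hR : R.IsGlobal) (γ : VField n M) :
    CovariantDerivative.ContMDiffCovariantDerivative (conn hR γ) ∞ := by
  refine ⟨⟨fun {σ} hσ => ?_⟩⟩
  let V : VField n M := ⟨σ, (contMDiffOn_univ.1 hσ).of_le (by simp)⟩
  refine ContMDiff.contMDiffOn (hR.isEtale.contMDiff_hom fun i => ?_)
  let Z := hR.isEtale.frame (EuclideanSpace.single i 1)
  have h1 := (hR.isEtale.dfield Z V).contMDiff.sub_section
    ((isSmooth_hessNorm hR Z V).smul_section γ.contMDiff)
  refine h1.congr fun q => ?_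
  exact congrArg (fun v => (⟨q, v⟩ : TangentBundle 𝓘(ℝ, Model n) M)) (conn_along hR γ Z V q)

end ExpCoordRep

end NormConnection

/-! ### Metric and connection as integrals on the `ℓ`-scale -/

section Expr

variable {X : Type*} [TopologicalSpace X] [MeasurableSpace X] {μ : Measure X} {n : ℕ} {M : Type*}
  [TopologicalSpace M] [ChartedSpace (Model n) M] [IsManifold 𝓘(ℝ, Model n) ∞ M]
  {G : Gauge} {e : M → X → ℝ}

namespace IsExpFamily

lemma ae_isSmooth (h : IsExpFamily G n μ e) : ∀ᵐ x ∂μ, IsSmooth n fun q => e q x := by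
  obtain ⟨N, hN, -, hsm, -⟩ := h.isStatisticalModel.exists_null
  filter_upwards [measure_eq_zero_iff_ae_notMem.1 hN] with x hx using hsm x hx

lemma integrable_metric (h : IsExpFamily G n μ e) (hc : IsCompatible G n μ e) (V W : VField n M)
    (p : M) : Integrable (fun x => G.rho (e p x) * (lieD V (fun q => G.ell (e q x)) p *
        lieD W (fun q => G.ell (e q x)) p)) μ := by
  refine (hc.integrable_metric V W p).neg.congr ?_
  filter_upwards [h.ae_isSmooth] with x hx
  rw [Pi.neg_apply, lieFst_lieSnd_dEval hx fun q => h.mem_I' q x, neg_neg]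

lemma metricExpr_eq (h : IsExpFamily G n μ e) (V W : VField n M) (p : M) :
    metricExpr G μ e V W p = ∫ x, G.rho (e p x) * (lieD V (fun q => G.ell (e q x)) p *
        lieD W (fun q => G.ell (e q x)) p) ∂μ := by
  rw [metricExpr, ← integral_neg]
  refine integral_congr_ae ?_
  filter_upwards [h.ae_isSmooth] with x hx
  rw [lieFst_lieSnd_dEval hx fun q => h.mem_I' q x, neg_neg]

lemma connExpr_eq (h : IsExpFamily G n μ e) (Z V W : VField n M) (p : M) :
    connExpr G μ e Z V W p = ∫ x, G.rho (e p x) * lieD W (fun q => G.ell (e q x)) p *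
        lieD Z (lieD V (fun q => G.ell (e q x))) p ∂μ := by
  rw [connExpr, ← integral_neg]
  refine integral_congr_ae ?_
  filter_upwards [h.ae_isSmooth] with x hx
  rw [lieSnd_lieSnd_lieFst_dEval hx fun q => h.mem_I' q x, neg_neg]

/-- As `dτ = ρ dℓ`, the integral that multiplies `Hess ψ` in the connection is a derivative of
`𝕀_τ`. -/
lemma exchange_tau (h : IsExpFamily G n μ e) (hτ : Exchange₁ n μ e G.τ) (V : VField n M) (p : M) :
    Integrable (fun x => G.rho (e p x) * lieD V (fun q => G.ell (e q x)) p) μ ∧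
      ∫ x, G.rho (e p x) * lieD V (fun q => G.ell (e q x)) p ∂μ = lieD V (II μ e G.τ) p := by
  have hae : (fun x => lieD V (fun q => G.τ (e q x)) p) =ᵐ[μ]
      fun x => G.rho (e p x) * lieD V (fun q => G.ell (e q x)) p := by
    filter_upwards [h.ae_isSmooth] with x hx using lieD_tau hx (fun q => h.mem_I' q x) V p
  exact ⟨(hτ V p).1.congr hae, by rw [(hτ V p).2, integral_congr_ae hae]⟩

end IsExpFamily

namespace ExpCoordRep

variable {R : ExpCoordRep G n e}

/-- The expression defining the connection in terms of the metric, of the flat connection of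
the coordinates, and of the derivative of `𝕀_τ`. -/
lemma connExpr_eq_metricExpr (hR : R.IsGlobal) (h : IsExpFamily G n μ e)
    (hc : IsCompatible G n μ e) (hτ : Exchange₁ n μ e G.τ) (Z V W : VField n M) (p : M) :
    connExpr G μ e Z V W p = metricExpr G μ e (hR.isEtale.dfield Z V) W p
      - hessNorm hR Z V p * lieD W (II μ e G.τ) p := by
  obtain ⟨h1, h2⟩ := h.exchange_tau hτ W p
  rw [h.connExpr_eq, h.metricExpr_eq, ← h2, ← integral_const_mul,
    ← integral_sub (h.integrable_metric hc _ _ p) (h1.const_mul _)]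
  refine integral_congr_ae (Eventually.of_forall fun x => ?_)
  simp only [lieD_lieD_ell hR h.isStatisticalModel.isDensitySet.pos]
  ring

/-- The derivatives of `ℓ ∘ e_x` separate tangent vectors, even up to null sets. -/
lemma eq_zero_of_lieD_ell_ae_eq_zero [T2Space M] [μ.IsOpenPosMeasure] (hR : R.IsGlobal)
    (h : IsExpFamily G n μ e) (hχ : IIExists μ e G.chi) {V : VField n M} {p : M}
    (hV : ∀ᵐ x ∂μ, lieD V (fun q => G.ell (e q x)) p = 0) : V p = 0 := by
  have hpos := h.isStatisticalModel.isDensitySet.pos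
  refine hR.isEtale.ext_of_mvfderiv ?_
  rw [map_zero]
  refine R.eq_zero_of_inner_ae_eq h.isStatisticalModel hχ (hR.mem_source p) (b := lieD V R.ψ p) ?_
  filter_upwards [hV] with x hx
  rw [R.lieD_ell hpos (hR.mem_source p)] at hx
  linarith

end ExpCoordRep

end Expr

/-! ### Positive definiteness and the Riemannian metric -/

section PosDef

variable {E : Type*} [NormedAddCommGroup E] [NormedSpace ℝ E] [FiniteDimensional ℝ E]

/-- The unit ball of a positive definite form on a finite dimensional space is bounded. -/
lemma isVonNBounded_of_pos (B : E →L[ℝ] E →L[ℝ] ℝ) (hB : ∀ v, v ≠ 0 → 0 < B v v) :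
    Bornology.IsVonNBounded ℝ {v : E | B v v < 1} := by
  rw [NormedSpace.isVonNBounded_iff, isBounded_iff_forall_norm_le]
  rcases subsingleton_or_nontrivial E with hE | hE
  · exact ⟨0, fun v _ => by rw [Subsingleton.elim v 0, norm_zero]⟩
  -- The minimum of the form on the compact unit sphere is positive, and by homogeneity it bounds
  -- the norm on the ball.
  have hcont : Continuous fun v : E => B v v := by fun_prop
  obtain ⟨u, hu, hmin⟩ := (isCompact_sphere (0 : E) 1).exists_isMinOn
    (NormedSpace.sphere_nonempty.2 zero_le_one) hcont.continuousOn
  have hu1 : ‖u‖ = 1 := by simpa using hu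
  have hc : 0 < B u u := hB u fun h0 => by simp [h0] at hu1
  refine ⟨Real.sqrt (1 / B u u), fun v hv => Real.le_sqrt_of_sq_le ?_⟩
  rcases eq_or_ne v 0 with rfl | hv0
  · simp [hc.le]
  have hn : ‖v‖ ≠ 0 := norm_ne_zero_iff.2 hv0
  have h1 : B u u ≤ B (‖v‖⁻¹ • v) (‖v‖⁻¹ • v) := hmin (by
    rw [mem_sphere_zero_iff_norm, norm_smul, norm_inv, norm_norm, inv_mul_cancel₀ hn])
  have h2 : B v v < 1 := hv
  have h3 : B (‖v‖⁻¹ • v) (‖v‖⁻¹ • v) = (‖v‖ ^ 2)⁻¹ * B v v := by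
    simp only [map_smul, smul_apply, smul_eq_mul]
    field_simp
  rw [le_div_iff₀ hc]
  rw [h3, inv_mul_eq_div, le_div_iff₀ (by positivity)] at h1
  linarith

/-- A bilinear form on a finite dimensional space, as a continuous bilinear form. -/
def continuousForm {E : Type*} [AddCommGroup E] [Module ℝ E] [TopologicalSpace E]
    [IsTopologicalAddGroup E] [ContinuousSMul ℝ E] [T2Space E] [FiniteDimensional ℝ E]
    (B : E →ₗ[ℝ] E →ₗ[ℝ] ℝ) : E →L[ℝ] E →L[ℝ] ℝ :=
  LinearMap.toContinuousLinearMap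
    ((LinearMap.toContinuousLinearMap : (E →ₗ[ℝ] ℝ) ≃ₗ[ℝ] E →L[ℝ] ℝ).toLinearMap ∘ₗ B)

end PosDef

section Metric

variable {X : Type*} [TopologicalSpace X] [MeasurableSpace X] {μ : Measure X} {n : ℕ} {M : Type*}
  [TopologicalSpace M] [ChartedSpace (Model n) M] [IsManifold 𝓘(ℝ, Model n) ∞ M]
  {G : Gauge} {e : M → X → ℝ} {R : ExpCoordRep G n e}

namespace ExpCoordRep

/-- Compatibility gives integrability along vector fields; frame fields pass through any two given
tangent vectors. -/
lemma integrable_fisher (hR : R.IsGlobal) (h : IsExpFamily G n μ e) (hc : IsCompatible G n μ e)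
    (p : M) (v w : TangentSpace 𝓘(ℝ, Model n) p) :
    Integrable (fun x => G.rho (e p x) *
      (mvfderiv 𝓘(ℝ, Model n) (fun q => G.ell (e q x)) p v *
        mvfderiv 𝓘(ℝ, Model n) (fun q => G.ell (e q x)) p w)) μ := by
  have := h.integrable_metric hc (hR.isEtale.frame (mvfderiv 𝓘(ℝ, Model n) R.θ p v))
    (hR.isEtale.frame (mvfderiv 𝓘(ℝ, Model n) R.θ p w)) p
  simpa only [lieD, hR.isEtale.frame_mvfderiv] using this

/-- The metric `∫ ρ(p) du du` on the tangent space at `p`, where `u = ℓ ∘ e`. -/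
def fisherForm (hR : R.IsGlobal) (h : IsExpFamily G n μ e) (hc : IsCompatible G n μ e) (p : M) :
    TangentSpace 𝓘(ℝ, Model n) p →L[ℝ] TangentSpace 𝓘(ℝ, Model n) p →L[ℝ] ℝ :=
  continuousForm (LinearMap.mk₂ ℝ (fun v w => ∫ x, G.rho (e p x) *
      (mvfderiv 𝓘(ℝ, Model n) (fun q => G.ell (e q x)) p v *
        mvfderiv 𝓘(ℝ, Model n) (fun q => G.ell (e q x)) p w) ∂μ)
    (fun v v' w => by
      rw [← integral_add (integrable_fisher hR h hc p v w) (integrable_fisher hR h hc p v' w)]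
      refine integral_congr_ae (Eventually.of_forall fun x => ?_)
      simp only [map_add]
      ring)
    (fun r v w => by
      rw [smul_eq_mul, ← integral_const_mul]
      refine integral_congr_ae (Eventually.of_forall fun x => ?_)
      simp only [map_smul, smul_eq_mul]
      ring)
    (fun v w w' => by
      rw [← integral_add (integrable_fisher hR h hc p v w) (integrable_fisher hR h hc p v w')]
      refine integral_congr_ae (Eventually.of_forall fun x => ?_)
      simp only [map_add]
      ring)
    (fun r v w => by
      rw [smul_eq_mul, ← integral_const_mul]
      refine integral_congr_ae (Eventually.of_forall fun x => ?_)
      simp only [map_smul, smul_eq_mul]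
      ring))

lemma fisherForm_apply (hR : R.IsGlobal) (h : IsExpFamily G n μ e) (hc : IsCompatible G n μ e)
    (p : M) (v w : TangentSpace 𝓘(ℝ, Model n) p) :
    fisherForm hR h hc p v w = ∫ x, G.rho (e p x) *
      (mvfderiv 𝓘(ℝ, Model n) (fun q => G.ell (e q x)) p v *
        mvfderiv 𝓘(ℝ, Model n) (fun q => G.ell (e q x)) p w) ∂μ := rfl

lemma fisherForm_vField (hR : R.IsGlobal) (h : IsExpFamily G n μ e) (hc : IsCompatible G n μ e)
    (V W : VField n M) (p : M) :
    fisherForm hR h hc p (V p) (W p) = metricExpr G μ e V W p := by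
  rw [h.metricExpr_eq, fisherForm_apply]
  rfl

/-- Definiteness of the weighted quadratic forms `∫ φ du du`, where `u = ℓ ∘ e`. -/
lemma eq_zero_of_mul_sq_integral_eq_zero [T2Space M] [μ.IsOpenPosMeasure] (hR : R.IsGlobal)
    (h : IsExpFamily G n μ e) (hχ : IIExists μ e G.chi) {p : M} {φ : X → ℝ} (hφ : ∀ x, 0 < φ x)
    (v : TangentSpace 𝓘(ℝ, Model n) p)
    (hint : Integrable (fun x => φ x * (mvfderiv 𝓘(ℝ, Model n) (fun q => G.ell (e q x)) p v *
        mvfderiv 𝓘(ℝ, Model n) (fun q => G.ell (e q x)) p v)) μ)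
    (h0 : ∫ x, φ x * (mvfderiv 𝓘(ℝ, Model n) (fun q => G.ell (e q x)) p v *
        mvfderiv 𝓘(ℝ, Model n) (fun q => G.ell (e q x)) p v) ∂μ = 0) : v = 0 := by
  have h1 := (integral_eq_zero_iff_of_nonneg
    (fun x => mul_nonneg (hφ x).le (mul_self_nonneg _)) hint).1 h0
  rw [← hR.isEtale.frame_mvfderiv v]
  refine eq_zero_of_lieD_ell_ae_eq_zero hR h hχ ?_
  filter_upwards [h1] with x hx
  rw [lieD, hR.isEtale.frame_mvfderiv]
  exact mul_self_eq_zero.1 ((mul_eq_zero.1 hx).resolve_left (hφ x).ne')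

lemma fisherForm_pos [T2Space M] [μ.IsOpenPosMeasure] (hR : R.IsGlobal)
    (h : IsExpFamily G n μ e) (hc : IsCompatible G n μ e) (hχ : IIExists μ e G.chi) (p : M)
    (v : TangentSpace 𝓘(ℝ, Model n) p) (hv : v ≠ 0) : 0 < fisherForm hR h hc p v v := by
  have hρ : ∀ x, 0 < G.rho (e p x) := fun x => G.rho_pos (h.mem_I' p x)
  rw [fisherForm_apply]
  refine lt_of_le_of_ne (integral_nonneg fun x => mul_nonneg (hρ x).le (mul_self_nonneg _))
    fun h0 => hv ?_
  exact eq_zero_of_mul_sq_integral_eq_zero hR h hχ hρ v (integrable_fisher hR h hc p v v) h0.symm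

/-- Testing on frame fields in both arguments reduces the claim to the coefficients `metricExpr`,
smooth by compatibility. -/
lemma contMDiff_fisherForm (hR : R.IsGlobal) (h : IsExpFamily G n μ e)
    (hc : IsCompatible G n μ e) :
    ContMDiff 𝓘(ℝ, Model n) (𝓘(ℝ, Model n).prod 𝓘(ℝ, Model n →L[ℝ] Model n →L[ℝ] ℝ)) ∞
      (fun p => Bundle.TotalSpace.mk' (Model n →L[ℝ] Model n →L[ℝ] ℝ)
        (E := fun p : M => TangentSpace 𝓘(ℝ, Model n) p →L[ℝ] TangentSpace 𝓘(ℝ, Model n) p →L[ℝ] ℝ)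
        p (fisherForm hR h hc p)) := by
  refine hR.isEtale.contMDiff_hom
    (V := fun p => TangentSpace 𝓘(ℝ, Model n) p →L[ℝ] Bundle.Trivial M ℝ p) fun i => ?_
  refine hR.isEtale.contMDiff_hom (V := Bundle.Trivial M ℝ)
    (φ := fun p => fisherForm hR h hc p (hR.isEtale.frame (EuclideanSpace.single i 1) p))
    fun j => ?_
  have h1 := hc.smooth_metric (hR.isEtale.frame (EuclideanSpace.single i 1))
    (hR.isEtale.frame (EuclideanSpace.single j 1))
  intro p
  rw [Bundle.contMDiffAt_section]
  refine (h1 p).congr_of_eventuallyEq (Eventually.of_forall fun q => ?_)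
  exact fisherForm_vField hR h hc _ _ q

/-- The Riemannian metric defined by the divergence. -/
def fisherMetric [T2Space M] [μ.IsOpenPosMeasure] (hR : R.IsGlobal)
    (h : IsExpFamily G n μ e) (hc : IsCompatible G n μ e) (hχ : IIExists μ e G.chi) :
    Metric n M where
  inner := fisherForm hR h hc
  symm p v w := by
    rw [fisherForm_apply, fisherForm_apply]
    refine integral_congr_ae (Eventually.of_forall fun x => ?_)
    ring
  pos := fisherForm_pos hR h hc hχ
  isVonNBounded p := isVonNBounded_of_pos (E := Model n) (fisherForm hR h hc p)
    (fisherForm_pos hR h hc hχ p)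
  contMDiff := contMDiff_fisherForm hR h hc

end ExpCoordRep

end Metric

/-! ### Gradients and existence of the induced connection -/

section Connection

variable {X : Type*} [TopologicalSpace X] [MeasurableSpace X] {μ : Measure X} {n : ℕ} {M : Type*}
  [TopologicalSpace M] [ChartedSpace (Model n) M] [IsManifold 𝓘(ℝ, Model n) ∞ M]
  {G : Gauge} {e : M → X → ℝ} {R : ExpCoordRep G n e}

namespace ExpCoordRep

/-- The metric in the coordinates, as an endomorphism of the model space. -/
def gram (hR : R.IsGlobal) (h : IsExpFamily G n μ e) (hc : IsCompatible G n μ e) (p : M) :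
    Model n →L[ℝ] Model n :=
  LinearMap.toContinuousLinearMap
    { toFun := fun a => WithLp.toLp 2 fun j => fisherForm hR h hc p (hR.isEtale.frame a p)
        (hR.isEtale.frame (EuclideanSpace.single j 1) p)
      map_add' := fun a b => by
        ext j
        simp [IsEtale.frame_apply]
      map_smul' := fun r a => by
        ext j
        simp [IsEtale.frame_apply] }

lemma gram_apply (hR : R.IsGlobal) (h : IsExpFamily G n μ e) (hc : IsCompatible G n μ e) (p : M)
    (a : Model n) (j : Fin n) : gram hR h hc p a j =
      fisherForm hR h hc p (hR.isEtale.frame a p)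
        (hR.isEtale.frame (EuclideanSpace.single j 1) p) := rfl

lemma inner_gram (hR : R.IsGlobal) (h : IsExpFamily G n μ e) (hc : IsCompatible G n μ e) (p : M)
    (a : Model n) (w : TangentSpace 𝓘(ℝ, Model n) p) :
    fisherForm hR h hc p (hR.isEtale.frame a p) w
      = ∑ j, mvfderiv 𝓘(ℝ, Model n) R.θ p w j * gram hR h hc p a j := by
  conv_lhs => rw [hR.isEtale.eq_sum_frame w]
  simp only [map_sum, map_smul, smul_eq_mul, gram_apply]

variable [T2Space M] [μ.IsOpenPosMeasure]

lemma isInvertible_gram (hR : R.IsGlobal) (h : IsExpFamily G n μ e) (hc : IsCompatible G n μ e)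
    (hχ : IIExists μ e G.chi) (p : M) : (gram hR h hc p).IsInvertible := by
  have hinj : Function.Injective (gram hR h hc p : Model n →ₗ[ℝ] Model n) := by
    rw [← LinearMap.ker_eq_bot, LinearMap.ker_eq_bot']
    intro a ha
    by_contra ha0
    have h1 : hR.isEtale.frame a p ≠ 0 := fun h0 => ha0 (by
      rw [← hR.isEtale.mvfderiv_frame a p, h0, map_zero])
    have h2 := fisherForm_pos hR h hc hχ p _ h1
    have ha' : gram hR h hc p a = 0 := ha
    rw [inner_gram, ha'] at h2
    simp at h2
  exact ⟨(LinearEquiv.ofInjectiveEndo _ hinj).toContinuousLinearEquiv,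
    ContinuousLinearMap.ext fun a => rfl⟩

/-- The Gram operator has smooth coefficients, and operator inversion is smooth at invertible
operators. -/
lemma contMDiff_gram_inverse (hR : R.IsGlobal) (h : IsExpFamily G n μ e)
    (hc : IsCompatible G n μ e) (hχ : IIExists μ e G.chi) {w : M → Model n}
    (hw : IsSmoothMap n w) : IsSmoothMap n fun p => (gram hR h hc p).inverse (w p) := by
  intro p
  have h1 : ContMDiffAt 𝓘(ℝ, Model n) 𝓘(ℝ, Model n →L[ℝ] Model n) ∞ (gram hR h hc) p := by
    refine contMDiffAt_clm_of_apply fun a => ?_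
    refine isSmoothMap_of_components (fun j => ?_) p
    have := hc.smooth_metric (hR.isEtale.frame a) (hR.isEtale.frame (EuclideanSpace.single j 1))
    refine this.congr fun q => ?_
    exact fisherForm_vField hR h hc _ _ q
  obtain ⟨L, hL⟩ := isInvertible_gram hR h hc hχ p
  have h2 : ContDiffAt ℝ ∞ ContinuousLinearMap.inverse (gram hR h hc p) :=
    hL ▸ contDiffAt_map_inverse L
  exact (h2.comp_contMDiffAt h1).clm_apply (hw p)

/-- The gradient of a smooth function with respect to the metric. -/
def grad (hR : R.IsGlobal) (h : IsExpFamily G n μ e) (hc : IsCompatible G n μ e)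
    (hχ : IIExists μ e G.chi) {f : M → ℝ} (hf : IsSmooth n f) : VField n M :=
  hR.isEtale.field _ (contMDiff_gram_inverse hR h hc hχ
    (isSmoothMap_of_components (f := fun p => WithLp.toLp 2 fun j =>
      lieD (hR.isEtale.frame (EuclideanSpace.single j 1)) f p) fun _ => hf.lieD _))

lemma fisherForm_grad (hR : R.IsGlobal) (h : IsExpFamily G n μ e) (hc : IsCompatible G n μ e)
    (hχ : IIExists μ e G.chi) {f : M → ℝ} (hf : IsSmooth n f) (p : M)
    (w : TangentSpace 𝓘(ℝ, Model n) p) :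
    fisherForm hR h hc p (grad hR h hc hχ hf p) w = mvfderiv 𝓘(ℝ, Model n) f p w := by
  let b : Model n := WithLp.toLp 2 fun j =>
    lieD (hR.isEtale.frame (EuclideanSpace.single j 1)) f p
  have h1 : grad hR h hc hχ hf p = hR.isEtale.frame ((gram hR h hc p).inverse b) p := rfl
  rw [h1, inner_gram, (isInvertible_gram hR h hc hχ p).self_apply_inverse]
  conv_rhs => rw [hR.isEtale.eq_sum_frame w]
  simp only [map_sum, map_smul, smul_eq_mul]
  rfl

/-- The divergence induces a Riemannian metric and a connection. -/
theorem exists_isInduced (hR : R.IsGlobal) (h : IsExpFamily G n μ e)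
    (hc : IsCompatible G n μ e) (hχ : IIExists μ e G.chi) (hτ : IISmooth n μ e G.τ)
    (hτ' : Exchange₁ n μ e G.τ) :
    ∃ (g : Metric n M) (nabla : Conn n M), IsInduced G μ e g nabla := by
  -- With `γ = grad 𝕀_τ`, the product `g(γ, W)` is `W(𝕀_τ)`, the factor of `Hess ψ` in
  -- `connExpr_eq_metricExpr`.
  refine ⟨fisherMetric hR h hc hχ, conn hR (grad hR h hc hχ hτ.2), smooth_conn hR _,
    fun V W p => fisherForm_vField hR h hc V W p, fun Z V W p => ?_⟩
  rw [conn_along, connExpr_eq_metricExpr hR h hc hτ', ← fisherForm_vField hR h hc]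
  change fisherForm hR h hc p _ _ = _
  rw [map_sub, map_smul, sub_apply, smul_apply, fisherForm_grad]
  rfl

end ExpCoordRep

end Connection

/-! ### Affine coordinates, potentials and the canonical divergence -/

section Affine

variable {n : ℕ} {M : Type*} [TopologicalSpace M] [ChartedSpace (Model n) M]
  [IsManifold 𝓘(ℝ, Model n) ∞ M] {F : Type*} [NormedAddCommGroup F] [NormedSpace ℝ F]

lemma coordField_eq_frame {ξ : OpenPartialHomeomorph M (Model n)} (hξ : IsEtale ξ) (i : Fin n) :
    coordField ξ i = hξ.frame (EuclideanSpace.single i 1) := rfl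

lemma Metric.eq_of_inner_eq (g : Metric n M) {p : M} {u v : TangentSpace 𝓘(ℝ, Model n) p}
    (h : ∀ w, g.inner p u w = g.inner p v w) : u = v := by
  by_contra huv
  have h1 := g.pos p (u - v) (sub_ne_zero.2 huv)
  rw [map_sub (g.inner p) u v, sub_apply, h, sub_self] at h1
  exact lt_irrefl _ h1

namespace IsEtale

variable {θ : M → Model n}

lemma frame_eq_sum (hθ : IsEtale θ) (a : Model n) (p : M) :
    hθ.frame a p = ∑ i, a i • hθ.frame (EuclideanSpace.single i 1) p := by
  conv_lhs => rw [hθ.eq_sum_frame (hθ.frame a p)]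
  simp only [hθ.mvfderiv_frame]

lemma mvfderiv_eq_zero_of_frame (hθ : IsEtale θ) {f : M → F} {p : M}
    (h : ∀ i, mvfderiv 𝓘(ℝ, Model n) f p (hθ.frame (EuclideanSpace.single i 1) p) = 0)
    (v : TangentSpace 𝓘(ℝ, Model n) p) : mvfderiv 𝓘(ℝ, Model n) f p v = 0 := by
  rw [hθ.eq_sum_frame v]
  simp only [map_sum, map_smul, h, smul_zero, Finset.sum_const_zero]

/-- A map with constant partial derivatives in the coordinates `θ` is affine in `θ`. -/
lemma sub_eq_mvfderiv_of_const [ConnectedSpace M] (hθ : IsEtale θ) {f : M → F}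
    (hf : IsSmoothMap n f)
    (h : ∀ i q r, mvfderiv 𝓘(ℝ, Model n) f q (hθ.frame (EuclideanSpace.single i 1) q)
      = mvfderiv 𝓘(ℝ, Model n) f r (hθ.frame (EuclideanSpace.single i 1) r)) (p q : M) :
    f q - f p = mvfderiv 𝓘(ℝ, Model n) f p (hθ.frame (θ q - θ p) p) := by
  let L : Model n →L[ℝ] F := LinearMap.toContinuousLinearMap
    { toFun := fun a => mvfderiv 𝓘(ℝ, Model n) f p (hθ.frame a p)
      map_add' := fun a b => by simp [frame_apply]
      map_smul' := fun r a => by simp [frame_apply] }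
  have hL : ∀ a r, mvfderiv 𝓘(ℝ, Model n) f r (hθ.frame a r) = L a := fun a r => by
    change _ = mvfderiv 𝓘(ℝ, Model n) f p (hθ.frame a p)
    rw [hθ.frame_eq_sum a r, hθ.frame_eq_sum a p]
    simp only [map_sum, map_smul, h _ r p]
  have hLθ : IsSmoothMap n fun r => L (θ r) := L.contMDiff.comp hθ.smooth
  -- The differential of `f` is `L` in every frame, so `f - L ∘ θ` has zero differential.
  have hconst := eq_of_mvfderiv_eq_zero (f := fun r => f r - L (θ r)) (hf.sub hLθ)
    (fun r v => by
      rw [mvfderiv_fun_sub (hf.isDiffAt r) (hLθ.isDiffAt r), sub_apply,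
        mvfderiv_clm_apply L (hθ.smooth.isDiffAt r), ← hL _ r, hθ.frame_mvfderiv]
      exact sub_self _) q p
  rw [hL, map_sub]
  exact sub_eq_sub_iff_sub_eq_sub.1 hconst

lemma IsParallel.mvfderiv_apply {hθ : IsEtale θ} {nabla : Conn n M} (h : hθ.IsParallel nabla)
    (V : VField n M) {p : M} (v : TangentSpace 𝓘(ℝ, Model n) p) :
    mvfderiv 𝓘(ℝ, Model n) θ p (nabla V p v)
      = mvfderiv 𝓘(ℝ, Model n) (fun q => mvfderiv 𝓘(ℝ, Model n) θ q (V q)) p v := by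
  have h1 := h (hθ.frame (mvfderiv 𝓘(ℝ, Model n) θ p v)) V p
  rw [Conn.along, hθ.frame_mvfderiv] at h1
  rw [h1, hθ.mvfderiv_dfield, hθ.frame_mvfderiv]

end IsEtale

/-- In `θ`-components the connection differentiates component functions, so vanishing curvature says
that the bracket acts as the commutator. -/
lemma IsCoordSystem.isFlat_of_isParallel {θ : OpenPartialHomeomorph M (Model n)}
    (hθ : IsCoordSystem θ) (hs : θ.source = univ) {nabla : Conn n M}
    (h : (hθ.isEtale hs).IsParallel nabla) : IsFlat nabla := by
  refine ⟨h.torsion_eq_zero, fun V W Z p => (hθ.isEtale hs).ext_of_mvfderiv ?_⟩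
  have h1 : ∀ V W : VField n M, nabla.along V W = (hθ.isEtale hs).dfield V W := fun V W =>
    funext fun q => h V W q
  rw [curvature, map_sub, map_sub, map_zero, h1 W Z, h1 V Z, h, h, Conn.along,
    h.mvfderiv_apply, hθ.mvfderiv_mlieBracket hs
      (contMDiff_mvfderiv_apply (hθ.isEtale hs).smooth Z), IsEtale.mvfderiv_dfield,
      IsEtale.mvfderiv_dfield]
  simp only [IsEtale.mvfderiv_dfield]
  exact sub_self _

/-- Differences of coordinates define the same tangent vectors in all global affine coordinate
systems. -/
lemma IsAffineCoord.frame_sub_eq [ConnectedSpace M] {θ : M → Model n} {hθ : IsEtale θ}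
    {nabla : Conn n M} (h : hθ.IsParallel nabla) {ξ : OpenPartialHomeomorph M (Model n)}
    (hξ : IsCoordSystem ξ) (hs : ξ.source = univ) (ha : IsAffineCoord nabla ξ) (p q : M) :
    (hξ.isEtale hs).frame (ξ q - ξ p) p = hθ.frame (θ q - θ p) p := by
  have hξ' := hξ.isEtale hs
  have h1 : ∀ (i j : Fin n) (r : M), nabla.along (hξ'.frame (EuclideanSpace.single i 1))
      (hξ'.frame (EuclideanSpace.single j 1)) r = 0 := fun i j r => by
    refine hξ'.ext_of_mvfderiv ?_
    rw [map_zero]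
    exact PiLp.ext fun k => ha r (hs ▸ mem_univ r) i j k
  refine hθ.ext_of_mvfderiv ?_
  rw [hθ.mvfderiv_frame]
  -- The map `θ` is affine in `ξ`: the derivative of `∂_j θ` along `∂_i` gives the `θ`-components of
  -- `∇_{∂_i} ∂_j`, which vanish.
  refine (hξ'.sub_eq_mvfderiv_of_const hθ.smooth (fun j => ?_) p q).symm
  refine eq_of_mvfderiv_eq_zero (contMDiff_mvfderiv_apply hθ.smooth _) fun r v => ?_
  refine hξ'.mvfderiv_eq_zero_of_frame (fun i => ?_) v
  rw [← h.mvfderiv_apply]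
  have := h1 i j r
  rw [Conn.along] at this
  rw [this, map_zero]

/-- Replaces the coordinate pairing by the differential of `Ψ` on a tangent vector, which can be
compared across affine coordinate systems. -/
lemma canonicalDiv_eq {ξ : OpenPartialHomeomorph M (Model n)} (hξ : IsEtale ξ) (Ψ : M → ℝ)
    (p q : M) : canonicalDiv ξ Ψ p q
      = Ψ q - Ψ p + mvfderiv 𝓘(ℝ, Model n) Ψ p (hξ.frame (ξ p - ξ q) p) := by
  rw [canonicalDiv, hξ.frame_eq_sum]
  simp only [map_sum, map_smul, smul_eq_mul, PiLp.inner_apply]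
  congr 1
  refine Finset.sum_congr rfl fun i _ => ?_
  rw [coordField_eq_frame hξ, lieD]
  exact mul_comm _ _

/-- The canonical divergence does not depend on the potential. -/
lemma IsPotentialOn.sub_eq [ConnectedSpace M] {θ : M → Model n} {hθ : IsEtale θ} {g : Metric n M}
    {nabla : Conn n M} (h : hθ.IsParallel nabla) {Φ Ψ : M → ℝ}
    (hΦ : IsPotentialOn g nabla univ Φ) (hΨ : IsPotentialOn g nabla univ Ψ) (p q : M) :
    Ψ q - Ψ p - mvfderiv 𝓘(ℝ, Model n) Ψ p (hθ.frame (θ q - θ p) p)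
      = Φ q - Φ p - mvfderiv 𝓘(ℝ, Model n) Φ p (hθ.frame (θ q - θ p) p) := by
  have hΦs : IsSmooth n Φ := contMDiffOn_univ.1 hΦ.1
  have hΨs : IsSmooth n Ψ := contMDiffOn_univ.1 hΨ.1
  have hδ : IsSmooth n fun q => Ψ q - Φ q := hΨs.sub hΦs
  have hsub : ∀ (V : VField n M) r, lieD V (fun q => Ψ q - Φ q) r = lieD V Ψ r - lieD V Φ r :=
    fun V r => lieD_sub V (hΨs.isDiffAt r) (hΦs.isDiffAt r)
  -- Frame fields are parallel, so both potentials have `g(V, frame a)` as their second derivative.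
  -- Their difference thus has constant partial derivatives.
  have key : ∀ (V : VField n M) (a : Model n) r,
      lieD V (lieD (hθ.frame a) fun q => Ψ q - Φ q) r = 0 := by
    intro V a r
    have h1 := hΦ.2 V (hθ.frame a) r (mem_univ r)
    have h2 := hΨ.2 V (hθ.frame a) r (mem_univ r)
    rw [hessian, lieD, lieD, h, hθ.dfield_frame, map_zero] at h1 h2
    have h3 : lieD (hθ.frame a) (fun q => Ψ q - Φ q)
        = fun r => lieD (hθ.frame a) Ψ r - lieD (hθ.frame a) Φ r := funext (hsub _)
    rw [h3, lieD_sub V ((hΨs.lieD _).isDiffAt r) ((hΦs.lieD _).isDiffAt r)]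
    simp only [lieD] at h1 h2 ⊢
    linarith
  have h4 := hθ.sub_eq_mvfderiv_of_const (f := fun q => Ψ q - Φ q) hδ (fun i => by
    refine eq_of_mvfderiv_eq_zero (hδ.lieD (hθ.frame (EuclideanSpace.single i 1))) fun r v => ?_
    have := key (hθ.frame (mvfderiv 𝓘(ℝ, Model n) θ r v)) (EuclideanSpace.single i 1) r
    rwa [lieD, hθ.frame_mvfderiv] at this) p q
  have h5 := hsub (hθ.frame (θ q - θ p)) p
  simp only [lieD] at h5
  rw [h5] at h4
  linarith

end Affine

section AffineCoord

variable {X : Type*} [TopologicalSpace X] {n : ℕ} {M : Type*}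
  [TopologicalSpace M] [ChartedSpace (Model n) M] [IsManifold 𝓘(ℝ, Model n) ∞ M]
  {G : Gauge} {e : M → X → ℝ} {R : ExpCoordRep G n e} {nabla : Conn n M}

lemma ExpCoordRep.isAffineCoord (hR : R.IsGlobal) (h : hR.isEtale.IsParallel nabla) :
    IsAffineCoord nabla R.θ := by
  intro p _ i j k
  rw [christoffel, coordField_eq_frame hR.isEtale, coordField_eq_frame hR.isEtale, h,
    hR.isEtale.dfield_frame, map_zero]
  rfl

end AffineCoord

/-! ### The affinity criterion, the potential and the divergence -/

section Main

variable {X : Type*} [TopologicalSpace X] [MeasurableSpace X] {μ : Measure X} {n : ℕ} {M : Type*}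
  [TopologicalSpace M] [ChartedSpace (Model n) M] [IsManifold 𝓘(ℝ, Model n) ∞ M]
  {G : Gauge} {e : M → X → ℝ} {R : ExpCoordRep G n e} {g : Metric n M} {nabla : Conn n M}

namespace ExpCoordRep

/-- The induced connection in terms of the flat connection of the coordinates. -/
lemma inner_along (hR : R.IsGlobal) (h : IsExpFamily G n μ e) (hc : IsCompatible G n μ e)
    (hτ : Exchange₁ n μ e G.τ) (hI : IsInduced G μ e g nabla) (Z V W : VField n M) (p : M) :
    g.inner p (nabla.along Z V p) (W p) = g.inner p (hR.isEtale.dfield Z V p) (W p)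
      - hessNorm hR Z V p * lieD W (II μ e G.τ) p := by
  rw [hI.conn_eq, hI.metric_eq, connExpr_eq_metricExpr hR h hc hτ]

lemma isParallel (hR : R.IsGlobal) (h : IsExpFamily G n μ e) (hc : IsCompatible G n μ e)
    (hτ : Exchange₁ n μ e G.τ) (hI : IsInduced G μ e g nabla)
    (hk : ∀ p q, II μ e G.τ p = II μ e G.τ q) : hR.isEtale.IsParallel nabla := by
  intro Z V p
  refine g.eq_of_inner_eq fun w => ?_
  have h1 := inner_along hR h hc hτ hI Z V
    (hR.isEtale.frame (mvfderiv 𝓘(ℝ, Model n) R.θ p w)) p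
  have h2 : II μ e G.τ = fun _ => II μ e G.τ p := funext fun q => hk q p
  rwa [h2, lieD_const, mul_zero, sub_zero, hR.isEtale.frame_mvfderiv] at h1

/-- Second derivatives of `e_x` along a constant vector field, where the second derivative of the
normalization vanishes. -/
lemma lieD_lieD_eval (hR : R.IsGlobal) (h : IsExpFamily G n μ e) {x : X}
    (he : IsSmooth n fun q => e q x) {a : Model n} {p : M}
    (hψ : hessNorm hR (hR.isEtale.frame a) (hR.isEtale.frame a) p = 0) :
    lieD (hR.isEtale.frame a) (lieD (hR.isEtale.frame a) fun q => e q x) p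
      = deriv G.chi (e p x) * G.chi (e p x) *
        (lieD (hR.isEtale.frame a) (fun q => G.ell (e q x)) p *
          lieD (hR.isEtale.frame a) (fun q => G.ell (e q x)) p) := by
  have hmem := fun q => h.mem_I' q x
  have hu := he.comp_of_contDiffOn G.isOpen_I G.contDiffOn_ell hmem
  have hχ := he.comp_of_contDiffOn G.isOpen_I G.contDiffOn_chi hmem
  have h1 : lieD (hR.isEtale.frame a) (fun q => e q x) = fun q =>
      G.chi (e q x) * lieD (hR.isEtale.frame a) (fun q => G.ell (e q x)) q := funext fun q => by
    rw [lieD_comp (f := fun q => e q x) _ (G.differentiableAt_ell (hmem q)) (he.isDiffAt q), Gauge.chi, one_div,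
      inv_mul_cancel_left₀ (G.deriv_ell_pos (hmem q)).ne']
  have hd : DifferentiableAt ℝ G.chi (e p x) :=
    (G.contDiffOn_chi.contDiffAt (G.isOpen_I.mem_nhds (hmem p))).differentiableAt (by simp)
  -- The frame field is parallel for the flat connection, so this second derivative is `-Hess ψ`,
  -- zero by hypothesis.
  have h2 : lieD (hR.isEtale.frame a)
      (lieD (hR.isEtale.frame a) (fun q => G.ell (e q x))) p = 0 := by
    rw [lieD_lieD_ell hR h.isStatisticalModel.isDensitySet.pos, hψ, lieD,
      hR.isEtale.dfield_frame, map_zero, sub_zero]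
  have h3 := congrFun h1 p
  rw [h1, lieD_mul _ (hχ.isDiffAt p) ((hu.lieD _).isDiffAt p), h2, mul_zero, zero_add,
    lieD_comp (f := fun q => e q x) _ hd (he.isDiffAt p), h3]
  ring

/-- If the coordinates are affine and `χ' > 0`, then `𝕀_τ` is constant. -/
lemma II_tau_eq_of_isAffineCoord [T2Space M] [ConnectedSpace M] [μ.IsOpenPosMeasure]
    (hR : R.IsGlobal) (h : IsExpFamily G n μ e) (hc : IsCompatible G n μ e)
    (hχ : IIExists μ e G.chi) (hτs : IISmooth n μ e G.τ)
    (hτ : Exchange₁ n μ e G.τ) (hI : IsInduced G μ e g nabla)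
    (hχ' : ∀ t ∈ G.I, 0 < deriv G.chi t) (ha : IsAffineCoord nabla R.θ) (p q : M) :
    II μ e G.τ p = II μ e G.τ q := by
  refine eq_of_mvfderiv_eq_zero hτs.2 (fun r v => ?_) p q
  refine hR.isEtale.mvfderiv_eq_zero_of_frame (fun i => ?_) v
  by_contra hne
  let V := hR.isEtale.frame (EuclideanSpace.single i 1)
  have h1 : nabla.along V V r = 0 := by
    refine hR.isEtale.ext_of_mvfderiv ?_
    rw [map_zero]
    exact PiLp.ext fun k => ha r (hR.mem_source r) i i k
  -- Both covariant derivatives of `V` along itself vanish, leaving `Hess ψ(V, V) · V(𝕀_τ) = 0`.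
  have h2 := inner_along hR h hc hτ hI V V V r
  rw [h1, hR.isEtale.dfield_frame, map_zero, zero_apply, zero_sub, zero_eq_neg] at h2
  have h3 : hessNorm hR V V r = 0 := (mul_eq_zero.1 h2).resolve_right hne
  have hae : (fun x => lieD V (lieD V fun q => e q x) r) =ᵐ[μ] fun x =>
      deriv G.chi (e r x) * G.chi (e r x) * (lieD V (fun q => G.ell (e q x)) r *
        lieD V (fun q => G.ell (e q x)) r) := by
    filter_upwards [h.ae_isSmooth] with x hx using lieD_lieD_eval hR h hx h3
  obtain ⟨h4, h5⟩ := h.isStatisticalModel.integral_lieD_lieD V V r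
  rw [integral_congr_ae hae] at h5
  have hV0 : V r = 0 := eq_zero_of_mul_sq_integral_eq_zero hR h hχ
    (fun x => mul_pos (hχ' _ (h.mem_I' r x)) (G.chi_pos (h.mem_I' r x))) (V r)
    (h4.congr hae) h5
  refine hne ?_
  change mvfderiv 𝓘(ℝ, Model n) (II μ e G.τ) r (V r) = 0
  rw [hV0, map_zero]

/-- The global potential of the Hessian structure. -/
lemma isPotentialOn (hR : R.IsGlobal) (h : IsExpFamily G n μ e) (hc : IsCompatible G n μ e)
    (hτs : IISmooth n μ e G.τ) (hI : IsInduced G μ e g nabla)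
    (hpar : hR.isEtale.IsParallel nabla) (hk : ∀ p q, II μ e G.τ p = II μ e G.τ q)
    (hs : IISmooth n μ e G.sStar) (hs₁ : Exchange₁ n μ e G.sStar)
    (hs₂ : Exchange₂ n μ e G.sStar) :
    IsPotentialOn g nabla univ (fun p => - II μ e G.sStar p + R.ψ p * II μ e G.τ p) := by
  have hΨ : IsSmooth n fun p => - II μ e G.sStar p + R.ψ p * II μ e G.τ p :=
    hs.2.neg.add (hR.isSmooth_ψ.mul hτs.2)
  refine ⟨hΨ.contMDiffOn, fun V W p _ => ?_⟩
  set k := II μ e G.τ p with hkdef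
  have hΨk : (fun p => - II μ e G.sStar p + R.ψ p * II μ e G.τ p)
      = fun p => k * R.ψ p - II μ e G.sStar p := funext fun q => by rw [hk q p]; ring
  have hψ := hR.isSmooth_ψ
  have hd : ∀ V : VField n M, lieD V (fun p => k * R.ψ p - II μ e G.sStar p)
      = fun p => k * lieD V R.ψ p - lieD V (II μ e G.sStar) p := fun V => funext fun q => by
    have : IsDiffAt n (fun p => k * R.ψ p) q := mdifferentiableAt_const.mul (hψ.isDiffAt q)
    rw [lieD_sub V this (hs.2.isDiffAt q), lieD_const_mul V _ (hψ.isDiffAt q)]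
  have hd2 : lieD V (fun p => k * lieD W R.ψ p - lieD W (II μ e G.sStar) p) p
      = k * lieD V (lieD W R.ψ) p - lieD V (lieD W (II μ e G.sStar)) p := by
    have : IsDiffAt n (fun p => k * lieD W R.ψ p) p :=
      mdifferentiableAt_const.mul ((hψ.lieD W).isDiffAt p)
    rw [lieD_sub V this ((hs.2.lieD W).isDiffAt p),
      lieD_const_mul V _ ((hψ.lieD W).isDiffAt p)]
  have hY : lieD (nabla.along V W) (fun p => k * R.ψ p - II μ e G.sStar p) p
      = k * lieD (hR.isEtale.dfield V W) R.ψ p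
        - lieD (hR.isEtale.dfield V W) (II μ e G.sStar) p := by
    rw [lieD, hpar V W p]
    exact congrFun (hd (hR.isEtale.dfield V W)) p
  rw [hessian, hΨk, hY, hd W, hd2, (hs₂ V W p).2, (hs₁ _ p).2]
  -- Differentiating `W s⋆ = -τ Wu` gives `-ρ Vu Wu - τ V(Wu)`. The flat part of `V(Wu)` reassembles
  -- into a first derivative of `s⋆`, and its Hessian part contributes `τ Hess ψ`.
  have hae : (fun x => lieD V (lieD W fun q => G.sStar (e q x)) p) =ᵐ[μ] fun x =>
      lieD (hR.isEtale.dfield V W) (fun q => G.sStar (e q x)) p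
        - G.rho (e p x) * (lieD V (fun q => G.ell (e q x)) p *
          lieD W (fun q => G.ell (e q x)) p) + hessNorm hR V W p * G.τ (e p x) := by
    filter_upwards [h.ae_isSmooth] with x hx
    have hmem := fun q => h.mem_I' q x
    have hu := hx.comp_of_contDiffOn G.isOpen_I G.contDiffOn_ell hmem
    have hτx := hx.comp_of_contDiffOn G.isOpen_I G.smooth_τ hmem
    have h1 : lieD W (fun q => G.sStar (e q x)) = fun q =>
        - (G.τ (e q x) * lieD W (fun q => G.ell (e q x)) q) := funext fun q => by
      rw [lieD_sStar hx hmem, neg_mul]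
    have h2 := lieD_lieD_ell hR h.isStatisticalModel.isDensitySet.pos V W p x
    rw [h1, lieD_neg, lieD_mul V (hτx.isDiffAt p) ((hu.lieD W).isDiffAt p), h2,
      lieD_tau hx hmem, lieD_sStar hx hmem]
    ring
  have hi : Integrable (fun x => lieD (hR.isEtale.dfield V W) (fun q => G.sStar (e q x)) p
      - G.rho (e p x) * (lieD V (fun q => G.ell (e q x)) p *
        lieD W (fun q => G.ell (e q x)) p)) μ :=
    ((hs₁ _ p).1).sub (h.integrable_metric hc V W p)
  rw [hI.metric_eq, h.metricExpr_eq, integral_congr_ae hae, integral_add hi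
    ((hτs.1 p).const_mul _), integral_sub ((hs₁ _ p).1) (h.integrable_metric hc V W p), integral_const_mul, hessNorm]
  change _ = _ - (_ + _ * k) - _
  ring

/-- The divergence as the canonical divergence of the global potential. -/
lemma divergence_eq (hR : R.IsGlobal) (h : IsExpFamily G n μ e)
    (hτs : IISmooth n μ e G.τ) (hk : ∀ p q, II μ e G.τ p = II μ e G.τ q)
    (hs : IISmooth n μ e G.sStar) (hs₁ : Exchange₁ n μ e G.sStar) (p q : M) :
    divergence G μ e p q = ENNReal.ofReal
      ((fun p => - II μ e G.sStar p + R.ψ p * II μ e G.τ p) q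
        - (fun p => - II μ e G.sStar p + R.ψ p * II μ e G.τ p) p
        - mvfderiv 𝓘(ℝ, Model n) (fun p => - II μ e G.sStar p + R.ψ p * II μ e G.τ p) p
          (hR.isEtale.frame (R.θ q - R.θ p) p)) ∧
      0 ≤ (fun p => - II μ e G.sStar p + R.ψ p * II μ e G.τ p) q
        - (fun p => - II μ e G.sStar p + R.ψ p * II μ e G.τ p) p
        - mvfderiv 𝓘(ℝ, Model n) (fun p => - II μ e G.sStar p + R.ψ p * II μ e G.τ p) p
          (hR.isEtale.frame (R.θ q - R.θ p) p) := by
  have hpos := h.isStatisticalModel.isDensitySet.pos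
  have hψ := hR.isSmooth_ψ
  set k := II μ e G.τ p with hkdef
  let V := hR.isEtale.frame (R.θ q - R.θ p)
  have hΨk : (fun p => - II μ e G.sStar p + R.ψ p * II μ e G.τ p)
      = fun p => k * R.ψ p - II μ e G.sStar p := funext fun q => by rw [hk q p]; ring
  have hd : lieD V (fun p => k * R.ψ p - II μ e G.sStar p) p
      = k * lieD V R.ψ p - lieD V (II μ e G.sStar) p := by
    have : IsDiffAt n (fun p => k * R.ψ p) p := mdifferentiableAt_const.mul (hψ.isDiffAt p)
    rw [lieD_sub V this (hs.2.isDiffAt p), lieD_const_mul V _ (hψ.isDiffAt p)]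
  -- As `V` has components `θ(q) - θ(p)`, the term `⟨θ(p) - θ(q), T⟩` in `ℓ(e_p) - ℓ(e_q)` equals
  -- `-Vu - Vψ`. This removes `T`, and `-τ Vu` is `V s⋆`.
  have hdae : (fun x => G.d (e p x) (e q x)) =ᵐ[μ] fun x => G.sStar (e p x) - G.sStar (e q x)
      + lieD V (fun r => G.sStar (e r x)) p
      + (R.ψ q - R.ψ p - lieD V R.ψ p) * G.τ (e p x) := by
    filter_upwards [h.ae_isSmooth] with x hx
    rw [G.d_eq_sStar, lieD_sStar hx fun r => h.mem_I' r x, R.lieD_ell hpos (hR.mem_source p),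
      R.ell_eq hpos (hR.mem_source p), R.ell_eq hpos (hR.mem_source q),
      hR.isEtale.mvfderiv_frame, inner_sub_left]
    ring
  have hi1 : Integrable (fun x => G.sStar (e p x) - G.sStar (e q x)) μ := (hs.1 p).sub (hs.1 q)
  have hi2 : Integrable (fun x => G.sStar (e p x) - G.sStar (e q x)
      + lieD V (fun r => G.sStar (e r x)) p) μ := hi1.add (hs₁ V p).1
  have hi3 := (hτs.1 p).const_mul (R.ψ q - R.ψ p - lieD V R.ψ p)
  -- All three terms are integrable, so the divergence is finite.
  have hint : Integrable (fun x => G.d (e p x) (e q x)) μ :=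
    (hi2.add hi3).congr hdae.symm
  have hnn : ∀ x, 0 ≤ G.d (e p x) (e q x) := fun x => G.d_nonneg (h.mem_I' p x) (h.mem_I' q x)
  have hval : ∫ x, G.d (e p x) (e q x) ∂μ
      = (k * R.ψ q - II μ e G.sStar q) - (k * R.ψ p - II μ e G.sStar p)
        - lieD V (fun p => k * R.ψ p - II μ e G.sStar p) p := by
    rw [integral_congr_ae hdae, integral_add hi2 hi3, integral_add hi1 (hs₁ V p).1,
      integral_sub (hs.1 p) (hs.1 q), ← (hs₁ V p).2, integral_const_mul, hd]
    change II μ e G.sStar p - II μ e G.sStar q + _ + _ * k = _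
    ring
  rw [hΨk]
  constructor
  · rw [divergence, ← ofReal_integral_eq_lintegral_ofReal hint (Eventually.of_forall hnn), hval]
    rfl
  · have : 0 ≤ ∫ x, G.d (e p x) (e q x) ∂μ := integral_nonneg hnn
    rw [hval] at this
    exact this

end ExpCoordRep

end Main

end InfoGeo

end

theorem theorem5p4
    {X : Type*} [TopologicalSpace X] [MeasurableSpace X] [BorelSpace X]
    (μ : Measure X) [μ.IsOpenPosMeasure]
    {n : ℕ} {M : Type*} [TopologicalSpace M] [T2Space M] [SecondCountableTopology M]
    [ConnectedSpace M] [ChartedSpace (Model n) M] [IsManifold 𝓘(ℝ, Model n) ∞ M]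
    (G : Gauge) (e : M → X → ℝ)
    (hexp : IsExpFamily G n μ e) (hcomp : IsCompatible G n μ e)
    (hχ : IIExists μ e G.chi) (hτ : IISmooth n μ e G.τ) (hτ' : Exchange₁ n μ e G.τ) :
    -- the metric, the connection and a global representation exist
    (∃ (g : Metric n M) (nabla : Conn n M), IsInduced G μ e g nabla) ∧
    (∃ R : ExpCoordRep G n e, R.IsGlobal) ∧
    ∀ (g : Metric n M) (nabla : Conn n M), IsInduced G μ e g nabla →
      -- affine coordinates
      (∀ R : ExpCoordRep G n e, R.IsGlobal →
        ((∀ p q, II μ e G.τ p = II μ e G.τ q) → IsAffineCoord nabla R.θ) ∧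
        ((∀ t ∈ G.I, 0 < deriv G.chi t) → IsAffineCoord nabla R.θ →
          ∀ p q, II μ e G.τ p = II μ e G.τ q)) ∧
      -- Hessian structure, global potential, canonical divergence
      ((∀ p q, II μ e G.τ p = II μ e G.τ q) → IISmooth n μ e G.sStar →
        Exchange₁ n μ e G.sStar → Exchange₂ n μ e G.sStar →
        IsHessianStructure g nabla ∧
        (∀ R : ExpCoordRep G n e, R.IsGlobal →
          IsPotentialOn g nabla univ (fun p => - II μ e G.sStar p + R.ψ p * II μ e G.τ p)) ∧
        (∀ (ξ : OpenPartialHomeomorph M (Model n)) (Ψ : M → ℝ),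
          IsCoordSystem ξ → ξ.source = univ → IsAffineCoord nabla ξ →
          IsPotentialOn g nabla univ Ψ →
          ∀ p p' : M, (divergence G μ e p p' : EReal) = (canonicalDiv ξ Ψ p p' : EReal))) := by
  obtain ⟨R₀, hR₀⟩ := hexp.exists_isGlobal hχ
  refine ⟨ExpCoordRep.exists_isInduced hR₀ hexp hcomp hχ hτ hτ', ⟨R₀, hR₀⟩,
    fun g nabla hI => ⟨fun R hR => ⟨fun hk => ?_, fun hχ' ha p q => ?_⟩,
      fun hk hs hs₁ hs₂ => ?_⟩⟩
  · exact ExpCoordRep.isAffineCoord hR (ExpCoordRep.isParallel hR hexp hcomp hτ' hI hk)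
  · exact ExpCoordRep.II_tau_eq_of_isAffineCoord hR hexp hcomp hχ hτ hτ' hI hχ' ha p q
  have hpot := fun (R : ExpCoordRep G n e) (hR : R.IsGlobal) =>
    ExpCoordRep.isPotentialOn hR hexp hcomp hτ hI
      (ExpCoordRep.isParallel hR hexp hcomp hτ' hI hk) hk hs hs₁ hs₂
  have hpar := ExpCoordRep.isParallel hR₀ hexp hcomp hτ' hI hk
  refine ⟨⟨R₀.isCoordSystem.isFlat_of_isParallel hR₀ hpar,
    fun p => ⟨univ, isOpen_univ, mem_univ p, _, hpot R₀ hR₀⟩⟩, hpot, fun ξ Ψ hξ hξs ha hΨ p q => ?_⟩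
  obtain ⟨h1, h2⟩ := ExpCoordRep.divergence_eq hR₀ hexp hτ hk hs hs₁ p q
  -- The pairing uses `ξ p - ξ q`; reversing the difference produces the minus sign, after which `ξ`
  -- can be exchanged for `R₀.θ`.
  have h3 : canonicalDiv ξ Ψ p q = Ψ q - Ψ p - mvfderiv 𝓘(ℝ, Model n) Ψ p
      (hR₀.isEtale.frame (R₀.θ q - R₀.θ p) p) := by
    rw [canonicalDiv_eq (hξ.isEtale hξs), ← neg_sub (ξ q), (hξ.isEtale hξs).frame_apply, map_neg, map_neg,
      ← (hξ.isEtale hξs).frame_apply, IsAffineCoord.frame_sub_eq hpar hξ hξs ha, ← sub_eq_add_neg]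
  rw [h1, h3, IsPotentialOn.sub_eq hpar (hpot R₀ hR₀) hΨ, EReal.coe_ennreal_ofReal,
    max_eq_left h2]
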